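/- Let $a,b,c,d$ be real with $a,b>0$ and $\delta:=c+d-a-b>0$. On $(0,1)$ consider the weights $w_1(x)={}_2F_1(c-b,d-b;\delta;1-x)$ and $w_2(x)=\frac cb\,{}_2F_1(c-b,d-b-1;\delta;1-x)$ and $\mathrm d\mu(x)=\frac{\Gamma(c)\Gamma(d)}{\Gamma(a)\Gamma(b)\Gamma(\delta)}x^{a-1}(1-x)^{\delta-1}\,\mathrm dx$. Put $X=(1,x,x^2,\dots)^\top$, $\xi=(w_1,w_2,xw_1,xw_2,x^2w_1,\dots)^\top$, and let $g=\int_0^1X\xi^\top\,\mathrm d\mu$ be the moment matrix. The tuple $(a,b,c,d)$ is assumed to be perfect, i.e. there is a Gauss--Borel factorization $g=S^{-1}H\tilde S^{-\top}$ with $S,\tilde S$ lower unitriangular and $H$ diagonal with nonzero diagonal entries. Let $J=S\Lambda S^{-1}$ be the Jacobi matrix ($\Lambda$ the shift matrix with ones on the first superdiagonal), let $q=H^{-1}\tilde S\xi$ be the vector of type I linear forms $q^{(n)}$, $n\ge 0$, and define the hypergeometric type I matrix $P_I$ of $(a,b,c,d)$ by $$(P_I)_{n,m}=\frac{q^{(m)}(1)}{q^{(n)}(1)}\,J_{m,n},\qquad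 n,m\ge 0 .$$ A uniform stochastic factorization of a semi-infinite matrix $P$ is a factorization $P=P^L P^U_2 P^U_1$ into stochastic matrices in which $P^L$ is a pure death matrix (nonzero entries only on the diagonal and the first subdiagonal), $P_2^U,P_1^U$ are pure birth matrices (nonzero entries only on the diagonal and the first superdiagonal), $P_2^U,P_1^U$ are Toeplitz, and $P^L$ is constant along its diagonals apart from its row $0$, which is necessarily $(1,0,0,\dots)$. Theorem. Among all stochastic hypergeometric type I matrices $P_I$ there is exactly one that has a uniform stochastic factorization, namely the matrix with row $0$ equal to $\frac1{27}(12,12,3,0,0,\dots)$ and with $\frac1{27}(8,12,6,1)$ in columns $n-1,n,n+1,n+2$, and zeros elsewhere, in each row $n\ge1$. The tuples $(a,b,c,d)$ whose type I matrix is this one are exactly $\left(\frac13,\frac23,\frac12,1\right)$ and $\left(\frac23,\frac13,\frac12,1\right)$. Its uniform stochastic factorization is unique: the pure death factor has row $0$ equal to $(1,0,0,\dots)$ and, in each row $n\ge1$, the entries $\left(\frac23,\frac13\right)$ in columns $n-1,n$; both pure birth factors have, in each row $n\ge 0$, the entries $\left(\frac23,\frac13\right)$ in columns $n,n+1$. 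-/

import Mathlib

noncomputable section

namespace HyperWalk

/-! Semi-infinite matrices are `Matrix ℕ ℕ ℝ`. -/

/-- Product of semi-infinite matrices. In every product used below each entry is a sum with only
finitely many nonzero terms. -/
def infMul (A B : Matrix ℕ ℕ ℝ) : Matrix ℕ ℕ ℝ :=
  fun n m => ∑' k, A n k * B k m

/-- The shift matrix `Λ`, with ones on the first superdiagonal. -/
def shift : Matrix ℕ ℕ ℝ := fun n m => if m = n + 1 then 1 else 0

/-- Lower unitriangular semi-infinite matrices. -/
def IsLowerUnitriangular (S : Matrix ℕ ℕ ℝ) : Prop :=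
  (∀ n, S n n = 1) ∧ ∀ n m, n < m → S n m = 0

/-- `(S, H, T)` is the Gauss--Borel factorization `g = S⁻¹ H T⁻ᵀ`, written as `S g Tᵀ = H`. -/
def IsGaussBorel (g S : Matrix ℕ ℕ ℝ) (H : ℕ → ℝ) (T : Matrix ℕ ℕ ℝ) : Prop :=
  IsLowerUnitriangular S ∧ IsLowerUnitriangular T ∧ (∀ n, H n ≠ 0) ∧
    infMul (infMul S g) T.transpose = Matrix.diagonal H

/-- `J = S Λ S⁻¹`, for a lower unitriangular `S`. -/
def IsJacobiMatrix (S J : Matrix ℕ ℕ ℝ) : Prop :=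
  ∃ R : Matrix ℕ ℕ ℝ, IsLowerUnitriangular R ∧ infMul S R = 1 ∧
    J = infMul (infMul S shift) R

/-! The hypergeometric system of weights `(w₁, w₂, dμ)` on `(0,1)`. -/

/-- The first weight, `₂F₁(c - b, d - b; δ; 1 - x)` with `δ = c + d - a - b`. -/
def weight₁ (a b c d x : ℝ) : ℝ :=
  ordinaryHypergeometric (c - b) (d - b) (c + d - a - b) (1 - x)

/-- The second weight, `(c / b) ₂F₁(c - b, d - b - 1; δ; 1 - x)`. -/
def weight₂ (a b c d x : ℝ) : ℝ :=
  c / b * ordinaryHypergeometric (c - b) (d - b - 1) (c + d - a - b) (1 - x)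

/-- The density of `dμ` with respect to the Lebesgue measure on `(0,1)`. -/
def density (a b c d x : ℝ) : ℝ :=
  Real.Gamma c * Real.Gamma d / (Real.Gamma a * Real.Gamma b * Real.Gamma (c + d - a - b)) *
    x ^ (a - 1) * (1 - x) ^ (c + d - a - b - 1)

/-- The vector of undressed linear forms `ξ = (w₁, w₂, x w₁, x w₂, x² w₁, x² w₂, …)`. -/
def undressed (a b c d : ℝ) (m : ℕ) (x : ℝ) : ℝ :=
  x ^ (m / 2) * (if Even m then weight₁ a b c d x else weight₂ a b c d x)

/-- The moment matrix `g = ∫ X ξᵀ dμ`, with `X = (1, x, x², …)`. -/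
def momentMatrix (a b c d : ℝ) : Matrix ℕ ℕ ℝ := fun n m =>
  ∫ x in (0 : ℝ)..1, x ^ n * undressed a b c d m x * density a b c d x

/-- The type I linear form `q⁽ⁿ⁾`, the `n`-th component of `H⁻¹ T ξ`. -/
def linearForm (a b c d : ℝ) (H : ℕ → ℝ) (T : Matrix ℕ ℕ ℝ) (n : ℕ) (x : ℝ) : ℝ :=
  (H n)⁻¹ * ∑ j ∈ Finset.range (n + 1), T n j * undressed a b c d j x

/-- Nonnegative entries and unit row sums. -/
def IsStochastic (P : Matrix ℕ ℕ ℝ) : Prop :=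
  (∀ n m, 0 ≤ P n m) ∧ ∀ n, HasSum (P n) 1

/-- `(a, b, c, d)` is a hypergeometric tuple (`a, b, δ > 0`) whose system of weights is perfect,
and `P` is the associated matrix of type I, `P n m = q⁽ᵐ⁾(1) / q⁽ⁿ⁾(1) * J m n`. -/
def IsTypeIMatrix (a b c d : ℝ) (P : Matrix ℕ ℕ ℝ) : Prop :=
  0 < a ∧ 0 < b ∧ 0 < c + d - a - b ∧
  ∃ (S : Matrix ℕ ℕ ℝ) (H : ℕ → ℝ) (T J : Matrix ℕ ℕ ℝ),
    IsGaussBorel (momentMatrix a b c d) S H T ∧ IsJacobiMatrix S J ∧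
    ∀ n m, P n m = linearForm a b c d H T m 1 / linearForm a b c d H T n 1 * J m n

/-- The hypergeometric type I matrix of `(a, b, c, d)` is `P`, and it is stochastic. -/
def IsTypeIStochasticMatrix (a b c d : ℝ) (P : Matrix ℕ ℕ ℝ) : Prop :=
  IsTypeIMatrix a b c d P ∧ IsStochastic P

/-! Pure birth and pure death factors. -/

/-- Stochastic matrices of pure birth chains: from `n` one stays or moves to `n + 1`. -/
def IsPureBirth (U : Matrix ℕ ℕ ℝ) : Prop :=
  IsStochastic U ∧ ∀ n m, m ≠ n → m ≠ n + 1 → U n m = 0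

/-- Stochastic matrices of pure death chains: from `n` one stays or moves to `n - 1`
(so the state `0` is absorbing). -/
def IsPureDeath (L : Matrix ℕ ℕ ℝ) : Prop :=
  IsStochastic L ∧ ∀ n m, m ≠ n → m + 1 ≠ n → L n m = 0

/-- A pure birth factor is uniform if it is a Toeplitz matrix. -/
def IsUniformBirth (U : Matrix ℕ ℕ ℝ) : Prop :=
  IsPureBirth U ∧ ∀ n m, U (n + 1) (m + 1) = U n m

/-- A pure death factor is uniform if it is constant along its diagonals apart from its row `0`,
which is always `(1, 0, 0, …)`. -/
def IsUniformDeath (L : Matrix ℕ ℕ ℝ) : Prop :=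
  IsPureDeath L ∧ ∀ n m, 1 ≤ n → L (n + 1) (m + 1) = L n m

/-- `P = L U₂ U₁` is a stochastic factorization with one pure death and two pure birth factors,
all of them uniform. -/
def IsUniformStochasticFactorization (P L U₂ U₁ : Matrix ℕ ℕ ℝ) : Prop :=
  IsUniformDeath L ∧ IsUniformBirth U₂ ∧ IsUniformBirth U₁ ∧ P = infMul (infMul L U₂) U₁

/-- The pure death factor with rows `(1, 0, …)`, `(2/3, 1/3, 0, …)`, `(0, 2/3, 1/3, 0, …)`, …. -/
def deathFactor : Matrix ℕ ℕ ℝ := fun n m =>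
  if n = 0 then (if m = 0 then 1 else 0)
  else if m + 1 = n then 2 / 3 else if m = n then 1 / 3 else 0

/-- The pure birth factor with rows `(2/3, 1/3, 0, …)`, `(0, 2/3, 1/3, 0, …)`, …. -/
def birthFactor : Matrix ℕ ℕ ℝ := fun n m =>
  if m = n then 2 / 3 else if m = n + 1 then 1 / 3 else 0

/-- The banded matrix with row `0` equal to `(12, 12, 3, 0, …) / 27` and with
`(8, 12, 6, 1) / 27` in the columns `n - 1, n, n + 1, n + 2` of every row `n ≥ 1`. -/
def uniformMatrix : Matrix ℕ ℕ ℝ := fun n m =>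
  if n = 0 then
    (if m = 0 then 12 / 27 else if m = 1 then 12 / 27 else if m = 2 then 3 / 27 else 0)
  else if m + 1 = n then 8 / 27 else if m = n then 12 / 27
  else if m = n + 1 then 6 / 27 else if m = n + 2 then 1 / 27 else 0

end HyperWalk

end

/-! Put `R = S⁻¹`, so that `R J = Λ R` and `R n k` is the `(0, k)` entry of `Jⁿ`. Since `P` is the
transpose of `J` conjugated by the diagonal of the numbers `q⁽ᵏ⁾(1)`, the entries `(Pⁿ) k 0` equal
`q⁽⁰⁾(1) R n k / q⁽ᵏ⁾(1)`. Moreover `g = R U` with `U = S g` upper triangular, so column 0 of `g`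
lists the return probabilities `(Pⁿ) 0 0`, and column 1 is a fixed combination of `(Pⁿ) 0 0` and
`(Pⁿ) 1 0`. Gauss's theorem evaluates these columns as `g n 0 = (a)ₙ(b)ₙ / ((c)ₙ(d)ₙ)` and `g n 1 =
c(b+n) / (b(c+n)) · g n 0`. Hence `(c + n) B (Pⁿ) 1 0 = n (Pⁿ) 0 0` for some `B ≠ 0`.

A uniform factorization forces `P` to be a `bandMatrix`, with `p(w) = p₀ + p₁w + p₂w²` and `s(w) = l
+ (1-l)w`. Such a walk goes down by single steps, so the generating functions `G_k(z)` of `(Pⁿ) k 0`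
satisfy `G_k = wᵏ G₀` with `w = z s(w) p(w)` and `G₀ = s(w) / (l(1-w))`. In the variable `w` the
relation becomes a polynomial identity of degree 4, whose coefficients leave one solution and `c =
1/2` (`bandMatrix_coefficients`, `bandMatrix_unique`). The first moments then give `d`, `a + b` and
`ab`.

Conversely, for that walk `(Pⁿ) j 0` is an explicit binomial coefficient (`ballot_succ`). Its
recurrence is that of the moments, and the Gauss--Borel factors can be written down from it. -/

noncomputable section

namespace HyperWalk

local notation "coeff₂₁" => ordinaryHypergeometricCoefficient (𝕂 := ℝ)

section

open Filter Topology

/-! ### Gauss's summation theorem -/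

/-- A form of Kummer's convergence test. -/
theorem summable_and_tendsto_of_kummer {u : ℕ → ℝ} {s : ℝ} (hs : 0 < s)
    (h : ∀ᶠ k : ℕ in atTop, s * |u k| ≤ k * |u k| - (k + 1) * |u (k + 1)|) :
    Summable u ∧ Tendsto (fun k : ℕ => k * u k) atTop (𝓝 0) := by
  obtain ⟨N, hN⟩ := eventually_atTop.1 h
  set w : ℕ → ℝ := fun k => ((k + N : ℕ) : ℝ) * |u (k + N)| with hw
  have hstep : ∀ k, s * |u (k + N)| ≤ w k - w (k + 1) := by
    intro k
    have := hN (k + N) (by omega)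
    simp only [hw]
    have e : k + 1 + N = k + N + 1 := by omega
    rw [e]
    push_cast at this ⊢
    linarith
  have hw0 : ∀ k, 0 ≤ w k := fun k => by positivity
  have hsumN : Summable fun k => |u (k + N)| := by
    refine summable_of_sum_range_le (c := w 0 / s) (fun k => abs_nonneg _) fun n => ?_
    rw [le_div_iff₀ hs]
    have : ∀ n, (∑ i ∈ Finset.range n, |u (i + N)|) * s ≤ w 0 - w n := by
      intro n
      induction n with
      | zero => simp
      | succ n ih =>
        rw [Finset.sum_range_succ, add_mul]
        have := hstep n
        linarith
    linarith [this n, hw0 n]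
  have hsum : Summable fun k => |u k| := (summable_nat_add_iff N).1 hsumN
  refine ⟨hsum.of_abs, ?_⟩
  have hanti : Antitone w := antitone_nat_of_succ_le fun k => by
    have := hstep k
    have : 0 ≤ s * |u (k + N)| := by positivity
    linarith
  have hlim : Tendsto w atTop (𝓝 (⨅ k, w k)) :=
    tendsto_atTop_ciInf hanti ⟨0, by rintro _ ⟨k, rfl⟩; exact hw0 k⟩
  set ℓ := ⨅ k, w k
  have hℓ : ∀ k, ℓ ≤ w k := fun k => hanti.le_of_tendsto hlim k
  have hℓ0 : 0 ≤ ℓ := ge_of_tendsto' hlim hw0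
  -- A positive limit would give `|u k| ≥ ℓ / k` for large `k`, against the divergence of the
  -- harmonic series.
  have hz : ℓ = 0 := by
    by_contra hne
    have hpos : 0 < ℓ := lt_of_le_of_ne hℓ0 (Ne.symm hne)
    have h1 : Summable fun k : ℕ => 1 / (((k + N : ℕ) : ℝ)) := by
      refine Summable.of_nonneg_of_le (fun k => by positivity) (fun k => ?_) (hsumN.mul_left ℓ⁻¹)
      have := hℓ k
      simp only [hw] at this
      rcases Nat.eq_zero_or_pos (k + N) with h0 | h0
      · simp [h0]
        positivity
      · have : (0 : ℝ) < ((k + N : ℕ) : ℝ) := by exact_mod_cast h0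
        rw [div_le_iff₀ this, inv_mul_eq_div, div_mul_eq_mul_div, le_div_iff₀ hpos]
        linarith
    exact Real.not_summable_one_div_natCast
      ((summable_nat_add_iff (f := fun n : ℕ => 1 / (n : ℝ)) N).1 h1)
  rw [hz] at hlim
  have hlim' : Tendsto (fun k : ℕ => (k : ℝ) * |u k|) atTop (𝓝 0) :=
    (tendsto_add_atTop_iff_nat (f := fun k : ℕ => (k : ℝ) * |u k|) N).1 hlim
  refine squeeze_zero_norm (fun k => ?_) hlim'
  rw [norm_mul, Real.norm_eq_abs, Real.norm_eq_abs, Nat.abs_cast]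

theorem ascPochhammer_eval_pos {γ : ℝ} (hγ : 0 < γ) (k : ℕ) :
    0 < (ascPochhammer ℝ k).eval γ := ascPochhammer_pos k γ hγ

theorem hypergeometricCoeff_succ {α β γ : ℝ} (hγ : 0 < γ) (k : ℕ) :
    (k + 1) * coeff₂₁ α β γ (k + 1) * (γ + k) = coeff₂₁ α β γ k * ((α + k) * (β + k)) := by
  have h1 := (ascPochhammer_eval_pos hγ k).ne'
  have h2 : γ + k ≠ 0 := by positivity
  have h3 : (k.factorial : ℝ) ≠ 0 := by positivity
  have h4 : (k + 1 : ℝ) ≠ 0 := by positivity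
  simp only [ordinaryHypergeometricCoefficient, ascPochhammer_succ_eval, Nat.factorial_succ]
  push_cast
  field_simp

theorem hypergeometricCoeff_add_one {α β γ : ℝ} (hγ : 0 < γ) (k : ℕ) :
    coeff₂₁ α β (γ + 1) k * (γ + k) = γ * coeff₂₁ α β γ k := by
  have key : ∀ k : ℕ, (ascPochhammer ℝ k).eval (γ + 1) * γ = (ascPochhammer ℝ k).eval γ * (γ + k) := by
    intro k
    induction k with
    | zero => simp
    | succ k ih =>
      simp only [ascPochhammer_succ_eval]
      push_cast
      linear_combination (γ + 1 + k) * ih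
  have h1 := (ascPochhammer_eval_pos hγ k).ne'
  have h2 := (ascPochhammer_eval_pos (γ := γ + 1) (by linarith) k).ne'
  simp only [ordinaryHypergeometricCoefficient]
  field_simp
  linear_combination -((ascPochhammer ℝ k).eval α * (ascPochhammer ℝ k).eval β) * key k

/-- Kummer's test with half of the available margin `γ - α - β`; the other half absorbs the bounded
terms for large `k`. -/
theorem hypergeometricCoeff_summable_and_tendsto {α β γ : ℝ} (hγ : 0 < γ) (h : 0 < γ - α - β) :
    Summable (coeff₂₁ α β γ) ∧
      Tendsto (fun k : ℕ => (k : ℝ) * coeff₂₁ α β γ k) atTop (𝓝 0) := by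
  refine summable_and_tendsto_of_kummer (s := (γ - α - β) / 2) (by linarith) ?_
  have e1 : ∀ᶠ k : ℕ in atTop, -α ≤ (k : ℝ) := tendsto_natCast_atTop_atTop.eventually_ge_atTop _
  have e2 : ∀ᶠ k : ℕ in atTop, -β ≤ (k : ℝ) := tendsto_natCast_atTop_atTop.eventually_ge_atTop _
  have e3 : ∀ᶠ k : ℕ in atTop, (2 * (α * β) + (γ - α - β) * γ) / (γ - α - β) ≤ (k : ℝ) :=
    tendsto_natCast_atTop_atTop.eventually_ge_atTop _
  filter_upwards [e1, e2, e3] with k h1 h2 h3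
  rw [div_le_iff₀ h] at h3
  have hk : (0 : ℝ) < γ + k := by positivity
  have hs := congrArg abs (hypergeometricCoeff_succ (α := α) (β := β) hγ k)
  rw [abs_mul, abs_mul, abs_mul _ ((α + k) * (β + k)), abs_of_pos hk,
    abs_of_nonneg (a := (k + 1 : ℝ)) (by positivity),
    abs_of_nonneg (a := (α + k) * (β + k)) (mul_nonneg (by linarith) (by linarith))] at hs
  have ht := abs_nonneg (coeff₂₁ α β γ k)
  set t := |coeff₂₁ α β γ k|
  set t' := |coeff₂₁ α β γ (k + 1)|
  have : t' * (k + 1) = t * ((α + k) * (β + k)) / (γ + k) := by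
    rw [eq_div_iff hk.ne']; linarith
  have e : k * t - (k + 1) * t' - (γ - α - β) / 2 * t =
      t * ((k * (γ - α - β) - (2 * (α * β) + (γ - α - β) * γ)) / 2) / (γ + k) := by
    rw [mul_comm _ t', this]
    field_simp
    ring
  have : 0 ≤ t * ((k * (γ - α - β) - (2 * (α * β) + (γ - α - β) * γ)) / 2) / (γ + k) :=
    div_nonneg (mul_nonneg ht (by linarith)) hk.le
  linarith

/-- The termwise difference of the two sides telescopes: its `n`-th partial sum is `-γ n` times the
`n`-th coefficient, which tends to 0. -/
theorem tsum_hypergeometricCoeff_contiguous {α β γ : ℝ} (hγ : 0 < γ) (h : 0 < γ - α - β) :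
    γ * (γ - α - β) * ∑' k, coeff₂₁ α β γ k =
      (γ - α) * (γ - β) * ∑' k, coeff₂₁ α β (γ + 1) k := by
  obtain ⟨hsum, hlim⟩ := hypergeometricCoeff_summable_and_tendsto hγ h
  have hsum' := (hypergeometricCoeff_summable_and_tendsto (α := α) (β := β) (γ := γ + 1)
    (by linarith) (by linarith)).1
  have hdiff := ((hsum.hasSum.mul_left (γ * (γ - α - β))).sub
    (hsum'.hasSum.mul_left ((γ - α) * (γ - β)))).tendsto_sum_nat
  have hpart : ∀ n : ℕ, ∑ k ∈ Finset.range n, (γ * (γ - α - β) * coeff₂₁ α β γ k -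
      (γ - α) * (γ - β) * coeff₂₁ α β (γ + 1) k) = -γ * (n * coeff₂₁ α β γ n) := by
    intro n
    induction n with
    | zero => simp
    | succ n ih =>
      rw [Finset.sum_range_succ, ih]
      have hn : γ + n ≠ 0 := by positivity
      have h1 := hypergeometricCoeff_succ (α := α) (β := β) hγ n
      have h2 := hypergeometricCoeff_add_one (α := α) (β := β) hγ n
      push_cast
      refine mul_right_cancel₀ hn ?_
      linear_combination γ * h1 - (γ - α) * (γ - β) * h2
  simp only [hpart] at hdiff
  have h0 := hlim.const_mul (-γ)
  rw [mul_zero] at h0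
  have := tendsto_nhds_unique hdiff h0
  linarith

theorem tsum_hypergeometricCoeff_eq_prod {α β γ : ℝ} (hγ : 0 < γ) (h : 0 < γ - α - β) (n : ℕ) :
    (∏ j ∈ Finset.range n, ((γ + j) * (γ - α - β + j))) * ∑' k, coeff₂₁ α β γ k =
      (∏ j ∈ Finset.range n, ((γ - α + j) * (γ - β + j))) * ∑' k, coeff₂₁ α β (γ + n) k := by
  induction n with
  | zero => simp
  | succ n ih =>
    have hn : (0 : ℝ) ≤ n := by positivity
    have := tsum_hypergeometricCoeff_contiguous (α := α) (β := β) (γ := γ + n) (by linarith)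
      (by linarith)
    rw [Finset.prod_range_succ, Finset.prod_range_succ]
    push_cast
    rw [← add_assoc]
    linear_combination (γ + n) * (γ - α - β + n) * ih +
      (∏ j ∈ Finset.range n, ((γ - α + j) * (γ - β + j))) * this

/-- The terms with `k ≥ 1` tend to 0 and are dominated by those at `γ`; only the term 1 at `k = 0`
survives. -/
theorem tendsto_tsum_hypergeometricCoeff {α β γ : ℝ} (hγ : 0 < γ) (h : 0 < γ - α - β) :
    Tendsto (fun n : ℕ => ∑' k, coeff₂₁ α β (γ + n) k) atTop (𝓝 1) := by
  have hsum := (hypergeometricCoeff_summable_and_tendsto hγ h).1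
  have h1 : (1 : ℝ) = ∑' k : ℕ, if k = 0 then 1 else 0 := by simp
  rw [h1]
  have hmono : ∀ k n : ℕ, (ascPochhammer ℝ k).eval γ ≤ (ascPochhammer ℝ k).eval (γ + n) := by
    intro k n
    induction k with
    | zero => simp
    | succ k ih =>
      simp only [ascPochhammer_succ_eval]
      have := ascPochhammer_eval_pos hγ k
      have hn : (0 : ℝ) ≤ n := by positivity
      exact mul_le_mul ih (by linarith) (by positivity) (by linarith)
  refine tendsto_tsum_of_dominated_convergence hsum.abs (fun k => ?_)
    (Eventually.of_forall fun n k => ?_)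
  · rcases k with _ | k
    · simp [ordinaryHypergeometricCoefficient]
    · simp only [ordinaryHypergeometricCoefficient]
      have : Tendsto (fun n : ℕ => (ascPochhammer ℝ (k + 1)).eval (γ + n)) atTop atTop := by
        refine tendsto_atTop_mono (f := fun n : ℕ => (ascPochhammer ℝ k).eval γ * n) (fun n => ?_) ?_
        · simp only [ascPochhammer_succ_eval]
          have := ascPochhammer_eval_pos hγ k
          exact mul_le_mul (hmono k n) (by linarith [(Nat.cast_nonneg k : (0 : ℝ) ≤ k)])
            (by positivity) (le_trans this.le (hmono k n))
        · exact tendsto_natCast_atTop_atTop.const_mul_atTop (ascPochhammer_eval_pos hγ k)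
      simpa using (tendsto_inv_atTop_zero.comp this).const_mul
        (((k + 1).factorial : ℝ)⁻¹ * (ascPochhammer ℝ (k + 1)).eval α *
          (ascPochhammer ℝ (k + 1)).eval β)
  · have h0 := ascPochhammer_eval_pos hγ k
    rw [Real.norm_eq_abs]
    simp only [ordinaryHypergeometricCoefficient, abs_mul, abs_inv]
    rw [abs_of_pos h0, abs_of_pos (h0.trans_le (hmono k n))]
    have := hmono k n
    gcongr

/-- Gauss's summation theorem. -/
theorem tsum_hypergeometricCoeff {α β γ : ℝ} (hγ : 0 < γ) (h : 0 < γ - α - β)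
    (hα : ∀ m : ℕ, γ - α ≠ -m) (hβ : ∀ m : ℕ, γ - β ≠ -m) :
    ∑' k, coeff₂₁ α β γ k =
      Real.Gamma γ * Real.Gamma (γ - α - β) / (Real.Gamma (γ - α) * Real.Gamma (γ - β)) := by
  have hα' := Real.Gamma_ne_zero hα
  have hβ' := Real.Gamma_ne_zero hβ
  have hlim := (((Real.GammaSeq_tendsto_Gamma γ).mul (Real.GammaSeq_tendsto_Gamma (γ - α - β))).div
    -- The products obtained by iterating the contiguous relation are the denominators in Euler's
    -- `GammaSeq`; powers of `n` and factorials cancel because `γ + (γ-α-β) = (γ-α) + (γ-β)`.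
    ((Real.GammaSeq_tendsto_Gamma (γ - α)).mul (Real.GammaSeq_tendsto_Gamma (γ - β)))
    (mul_ne_zero hα' hβ')).mul
      ((tendsto_tsum_hypergeometricCoeff hγ h).comp (tendsto_add_atTop_nat 1))
  rw [mul_one] at hlim
  refine tendsto_nhds_unique (tendsto_const_nhds.congr' ?_) hlim
  filter_upwards [eventually_gt_atTop 0] with n hn
  have hn' : (0 : ℝ) < n := by exact_mod_cast hn
  have hp := tsum_hypergeometricCoeff_eq_prod hγ h (n + 1)
  simp only [Finset.prod_mul_distrib] at hp
  have p1 : ∏ j ∈ Finset.range (n + 1), (γ + (j : ℝ)) ≠ 0 :=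
    Finset.prod_ne_zero_iff.2 fun j _ => by positivity
  have p2 : ∏ j ∈ Finset.range (n + 1), (γ - α - β + (j : ℝ)) ≠ 0 :=
    Finset.prod_ne_zero_iff.2 fun j _ => by positivity
  have p3 : ∏ j ∈ Finset.range (n + 1), (γ - α + (j : ℝ)) ≠ 0 :=
    Finset.prod_ne_zero_iff.2 fun j _ h => hα j (by linarith)
  have p4 : ∏ j ∈ Finset.range (n + 1), (γ - β + (j : ℝ)) ≠ 0 :=
    Finset.prod_ne_zero_iff.2 fun j _ h => hβ j (by linarith)
  have hpow : (n : ℝ) ^ γ * (n : ℝ) ^ (γ - α - β) = (n : ℝ) ^ (γ - α) * (n : ℝ) ^ (γ - β) := by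
    rw [← Real.rpow_add hn', ← Real.rpow_add hn']
    ring_nf
  have q1 := (Real.rpow_pos_of_pos hn' (γ - α)).ne'
  have q2 := (Real.rpow_pos_of_pos hn' (γ - β)).ne'
  have q3 : (n.factorial : ℝ) ≠ 0 := by positivity
  simp only [Pi.div_apply, Real.GammaSeq, Function.comp_apply]
  have hg : ∀ {g₁ g₂ g₃ g₄ f r₁ r₂ r₃ r₄ x y : ℝ}, g₃ ≠ 0 → g₄ ≠ 0 → f ≠ 0 → r₁ ≠ 0 → r₂ ≠ 0 →
      r₃ ≠ 0 → r₄ ≠ 0 → g₁ * g₂ = g₃ * g₄ → r₁ * r₂ * x = r₃ * r₄ * y →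
      x = g₁ * f / r₁ * (g₂ * f / r₂) / (g₃ * f / r₃ * (g₄ * f / r₄)) * y := by
    intro g₁ g₂ g₃ g₄ f r₁ r₂ r₃ r₄ x y _ _ _ _ _ _ _ e₁ e₂
    field_simp
    linear_combination g₃ * g₄ * e₂ - r₃ * r₄ * y * e₁
  exact hg q1 q2 q3 p1 p2 p3 p4 hpow hp

end

section

open MeasureTheory Set

/-! ### Moments of the hypergeometric weights -/

theorem integrableOn_and_integral_beta {p q : ℝ} (hp : 0 < p) (hq : 0 < q) :
    IntegrableOn (fun x : ℝ => x ^ (p - 1) * (1 - x) ^ (q - 1)) (Ioo 0 1) ∧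
      ∫ x in Ioo (0 : ℝ) 1, x ^ (p - 1) * (1 - x) ^ (q - 1) =
        Real.Gamma p * Real.Gamma q / Real.Gamma (p + q) := by
  have hp' : 0 < (p : ℂ).re := by simpa
  have hq' : 0 < (q : ℂ).re := by simpa
  have hcongr : ∀ x ∈ Ioo (0 : ℝ) 1, (x : ℂ) ^ ((p : ℂ) - 1) * (1 - (x : ℂ)) ^ ((q : ℂ) - 1) =
      ((x ^ (p - 1) * (1 - x) ^ (q - 1) : ℝ) : ℂ) := by
    intro x hx
    push_cast
    rw [Complex.ofReal_cpow hx.1.le, Complex.ofReal_cpow (by linarith [hx.2])]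
    push_cast
    rfl
  constructor
  · have h := Complex.betaIntegral_convergent hp' hq'
    rw [intervalIntegrable_iff_integrableOn_Ioo_of_le zero_le_one] at h
    have h2 := (h.congr_fun hcongr measurableSet_Ioo).re
    simpa [IntegrableOn] using h2
  · have h := Complex.betaIntegral_eq_Gamma_mul_div p q hp' hq'
    rw [Complex.betaIntegral, intervalIntegral.integral_of_le zero_le_one,
      integral_Ioc_eq_integral_Ioo, setIntegral_congr_fun measurableSet_Ioo hcongr,
      integral_complex_ofReal, ← Complex.ofReal_add, Complex.Gamma_ofReal, Complex.Gamma_ofReal,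
      Complex.Gamma_ofReal] at h
    exact_mod_cast h

theorem Gamma_add_natCast_eq_ascPochhammer {x : ℝ} (hx : 0 < x) (k : ℕ) :
    Real.Gamma (x + k) = (ascPochhammer ℝ k).eval x * Real.Gamma x := by
  induction k with
  | zero => simp
  | succ k ih =>
    have h : x + k ≠ 0 := by positivity
    push_cast
    rw [← add_assoc, Real.Gamma_add_one h, ih, ascPochhammer_succ_eval]
    ring

/-- Integrating the series termwise, each beta integral replaces `(δ)ₖ` by `(a+δ)ₖ` in the
denominator, which leaves a Gauss sum with lower parameter `a + δ`. -/
theorem integral_beta_mul_hypergeometric {a δ α β : ℝ} (ha : 0 < a) (hδ : 0 < δ)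
    (hs : 0 < a + δ - α - β) (hα : ∀ m : ℕ, a + δ - α ≠ -m) (hβ : ∀ m : ℕ, a + δ - β ≠ -m) :
    ∫ x in Ioo (0 : ℝ) 1, x ^ (a - 1) * (1 - x) ^ (δ - 1) *
        ordinaryHypergeometric α β δ (1 - x) =
      Real.Gamma a * Real.Gamma δ * Real.Gamma (a + δ - α - β) /
        (Real.Gamma (a + δ - α) * Real.Gamma (a + δ - β)) := by
  have hγ : 0 < a + δ := by linarith
  have hG := (Real.Gamma_pos_of_pos hγ).ne'
  have hterm : ∀ (k : ℕ), ∀ x ∈ Ioo (0 : ℝ) 1,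
      coeff₂₁ α β δ k * (x ^ (a - 1) * (1 - x) ^ (δ + k - 1)) =
        x ^ (a - 1) * (1 - x) ^ (δ - 1) * (coeff₂₁ α β δ k * (1 - x) ^ k) := by
    intro k x hx
    rw [show δ + k - 1 = δ - 1 + k by ring, Real.rpow_add_natCast (by linarith [hx.2])]
    ring
  have hB : ∀ k : ℕ, coeff₂₁ α β δ k *
      (Real.Gamma a * Real.Gamma (δ + k) / Real.Gamma (a + (δ + k))) =
      Real.Gamma a * Real.Gamma δ / Real.Gamma (a + δ) * coeff₂₁ α β (a + δ) k := by
    intro k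
    have h1 := (ascPochhammer_eval_pos hδ k).ne'
    have h2 := (ascPochhammer_eval_pos hγ k).ne'
    rw [← add_assoc, Gamma_add_natCast_eq_ascPochhammer hδ, Gamma_add_natCast_eq_ascPochhammer hγ]
    simp only [ordinaryHypergeometricCoefficient]
    field_simp
  have hbeta := fun k : ℕ => integrableOn_and_integral_beta (q := δ + k) ha (by positivity)
  have hsum := (hypergeometricCoeff_summable_and_tendsto hγ hs).1
  have hF := hasSum_integral_of_summable_integral_norm (μ := volume.restrict (Ioo (0 : ℝ) 1))
    (F := fun (k : ℕ) (x : ℝ) => coeff₂₁ α β δ k * (x ^ (a - 1) * (1 - x) ^ (δ + k - 1)))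
    (fun k => (hbeta k).1.const_mul _) (by
      have : ∀ k : ℕ, ∫ x in Ioo (0 : ℝ) 1,
          ‖coeff₂₁ α β δ k * (x ^ (a - 1) * (1 - x) ^ (δ + k - 1))‖ =
          |Real.Gamma a * Real.Gamma δ / Real.Gamma (a + δ) * coeff₂₁ α β (a + δ) k| := by
        intro k
        rw [← hB, ← (hbeta k).2, abs_mul, ← Real.norm_eq_abs, abs_of_nonneg, ← integral_const_mul]
        · refine setIntegral_congr_fun measurableSet_Ioo fun x hx => ?_
          have h1 := Real.rpow_nonneg hx.1.le (a - 1)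
          have h2 := Real.rpow_nonneg (sub_nonneg.2 hx.2.le) (δ + k - 1)
          simp only [norm_mul, Real.norm_of_nonneg h1, Real.norm_of_nonneg h2]
        · refine setIntegral_nonneg measurableSet_Ioo fun x hx => ?_
          exact mul_nonneg (Real.rpow_nonneg hx.1.le _)
            (Real.rpow_nonneg (sub_nonneg.2 hx.2.le) _)
      simp only [this]
      exact (hsum.mul_left _).abs)
  have hI : ∀ k : ℕ, ∫ x in Ioo (0 : ℝ) 1,
      coeff₂₁ α β δ k * (x ^ (a - 1) * (1 - x) ^ (δ + k - 1)) =
      Real.Gamma a * Real.Gamma δ / Real.Gamma (a + δ) * coeff₂₁ α β (a + δ) k := fun k => by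
    rw [integral_const_mul, (hbeta k).2, hB]
  simp only [hI] at hF
  have h := hF.unique (hsum.hasSum.mul_left _)
  rw [tsum_hypergeometricCoeff hγ hs hα hβ] at h
  rw [setIntegral_congr_fun (g := fun x => ∑' k : ℕ,
    coeff₂₁ α β δ k * (x ^ (a - 1) * (1 - x) ^ (δ + k - 1))) measurableSet_Ioo, h]
  · field_simp
  · intro x hx
    simp only [ordinaryHypergeometric_eq_tsum, smul_eq_mul]
    rw [← tsum_mul_left]
    exact tsum_congr fun k => (hterm k x hx).symm

theorem integral_weight₁_mul_density {a b c d : ℝ} (ha : 0 < a) (hb : 0 < b)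
    (hδ : 0 < c + d - a - b) (hc : ∀ m : ℕ, c ≠ -m) (hd : ∀ m : ℕ, d ≠ -m) :
    ∫ x in Ioo (0 : ℝ) 1, weight₁ a b c d x * density a b c d x = 1 := by
  have h := integral_beta_mul_hypergeometric (a := a) (δ := c + d - a - b) (α := c - b)
    (β := d - b) ha hδ (by linarith) (fun m h => hd m (by linarith)) (fun m h => hc m (by linarith))
  rw [show a + (c + d - a - b) - (c - b) - (d - b) = b by ring,
    show a + (c + d - a - b) - (c - b) = d by ring,
    show a + (c + d - a - b) - (d - b) = c by ring] at h
  have : ∀ x, weight₁ a b c d x * density a b c d x =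
      Real.Gamma c * Real.Gamma d / (Real.Gamma a * Real.Gamma b * Real.Gamma (c + d - a - b)) *
      (x ^ (a - 1) * (1 - x) ^ (c + d - a - b - 1) *
        ordinaryHypergeometric (c - b) (d - b) (c + d - a - b) (1 - x)) := fun x => by
    simp only [weight₁, density]
    ring
  simp only [this]
  rw [integral_const_mul, h]
  have := (Real.Gamma_pos_of_pos ha).ne'
  have := (Real.Gamma_pos_of_pos hb).ne'
  have := (Real.Gamma_pos_of_pos hδ).ne'
  have := Real.Gamma_ne_zero hc
  have := Real.Gamma_ne_zero hd
  field_simp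

/-- Up to a constant, `xⁿ dμ` is the measure of the tuple with all four parameters raised by `n`.
The first weight depends only on differences that this shift preserves, so the normalized total mass
gives the moment. -/
theorem momentMatrix_zero_right {a b c d : ℝ} (ha : 0 < a) (hb : 0 < b)
    (hδ : 0 < c + d - a - b) (hc : ∀ m : ℕ, c ≠ -m) (hd : ∀ m : ℕ, d ≠ -m) (n : ℕ) :
    momentMatrix a b c d n 0 =
      Real.Gamma c * Real.Gamma d * (Real.Gamma (a + n) * Real.Gamma (b + n)) /
        (Real.Gamma a * Real.Gamma b * (Real.Gamma (c + n) * Real.Gamma (d + n))) := by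
  have hc' : ∀ m : ℕ, c + n ≠ -m := fun m h => hc (n + m) (by push_cast; linarith)
  have hd' : ∀ m : ℕ, d + n ≠ -m := fun m h => hd (n + m) (by push_cast; linarith)
  have han : 0 < a + n := by positivity
  have hbn : 0 < b + n := by positivity
  have eδ : c + n + (d + n) - (a + n) - (b + n) = c + d - a - b := by ring
  have h := integral_weight₁_mul_density han hbn (by rwa [eδ]) hc' hd'
  have g1 := (Real.Gamma_pos_of_pos ha).ne'
  have g2 := (Real.Gamma_pos_of_pos hb).ne'
  have g3 := (Real.Gamma_pos_of_pos hδ).ne'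
  have g4 := Real.Gamma_ne_zero hc'
  have g5 := Real.Gamma_ne_zero hd'
  have g6 := (Real.Gamma_pos_of_pos han).ne'
  have g7 := (Real.Gamma_pos_of_pos hbn).ne'
  rw [momentMatrix, intervalIntegral.integral_of_le zero_le_one, integral_Ioc_eq_integral_Ioo]
  refine Eq.trans ?_ ((congrArg (_ * ·) h).trans (mul_one _))
  rw [← integral_const_mul]
  refine setIntegral_congr_fun measurableSet_Ioo fun x hx => ?_
  have hx0 : x ≠ 0 := (show 0 < x from hx.1).ne'
  simp only [undressed, weight₁, density, eδ, show c + n - (b + n) = c - b by ring,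
    show d + n - (b + n) = d - b by ring, show a + n - 1 = a - 1 + n by ring,
    Real.rpow_add_natCast hx0]
  simp
  field_simp

theorem density_add_one {a b c d : ℝ} (hb : 0 < b) (hc : c ≠ 0) (x : ℝ) :
    density a (b + 1) (c + 1) d x = c / b * density a b c d x := by
  simp only [density, Real.Gamma_add_one hb.ne', Real.Gamma_add_one hc,
    show c + 1 + d - a - (b + 1) = c + d - a - b by ring]
  field_simp

/-- Raising `b` and `c` by 1 keeps `δ` and `c - b`, lowers `d - b` by 1 and multiplies the density
by `c / b`: the second weight is the first weight of the shifted system. -/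
theorem momentMatrix_one_right {a b c d : ℝ} (hb : 0 < b) (hc : c ≠ 0) (n : ℕ) :
    momentMatrix a b c d n 1 = momentMatrix a (b + 1) (c + 1) d n 0 := by
  simp only [momentMatrix, undressed, density_add_one hb hc, weight₁, weight₂,
    show c + 1 + d - a - (b + 1) = c + d - a - b by ring, show c + 1 - (b + 1) = c - b by ring,
    show d - (b + 1) = d - b - 1 by ring]
  congr 1
  ext x
  simp
  ring

theorem momentMatrix_add_two (a b c d : ℝ) (n m : ℕ) :
    momentMatrix a b c d n (m + 2) = momentMatrix a b c d (n + 1) m := by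
  simp only [momentMatrix, undressed]
  congr 1
  ext x
  rw [show (m + 2) / 2 = m / 2 + 1 by omega]
  have : Even (m + 2) ↔ Even m := by simp [Nat.even_add]
  simp only [this]
  ring

theorem momentMatrix_zero_zero {a b c d : ℝ} (ha : 0 < a) (hb : 0 < b)
    (hδ : 0 < c + d - a - b) (hc : ∀ m : ℕ, c ≠ -m) (hd : ∀ m : ℕ, d ≠ -m) :
    momentMatrix a b c d 0 0 = 1 := by
  rw [momentMatrix_zero_right ha hb hδ hc hd]
  have g1 := (Real.Gamma_pos_of_pos ha).ne'
  have g2 := (Real.Gamma_pos_of_pos hb).ne'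
  have g4 := Real.Gamma_ne_zero hc
  have g5 := Real.Gamma_ne_zero hd
  simp only [Nat.cast_zero, add_zero]
  field_simp

theorem momentMatrix_succ_zero {a b c d : ℝ} (ha : 0 < a) (hb : 0 < b)
    (hδ : 0 < c + d - a - b) (hc : ∀ m : ℕ, c ≠ -m) (hd : ∀ m : ℕ, d ≠ -m) (n : ℕ) :
    (c + n) * (d + n) * momentMatrix a b c d (n + 1) 0 =
      (a + n) * (b + n) * momentMatrix a b c d n 0 := by
  have hc' : ∀ m : ℕ, c + n ≠ -m := fun m h => hc (n + m) (by push_cast; linarith)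
  have hd' : ∀ m : ℕ, d + n ≠ -m := fun m h => hd (n + m) (by push_cast; linarith)
  have hcn : c + n ≠ 0 := by simpa using hc' 0
  have hdn : d + n ≠ 0 := by simpa using hd' 0
  have g1 := (Real.Gamma_pos_of_pos ha).ne'
  have g2 := (Real.Gamma_pos_of_pos hb).ne'
  have g4 := Real.Gamma_ne_zero hc'
  have g5 := Real.Gamma_ne_zero hd'
  rw [momentMatrix_zero_right ha hb hδ hc hd, momentMatrix_zero_right ha hb hδ hc hd]
  push_cast
  simp only [← add_assoc]
  rw [Real.Gamma_add_one hcn, Real.Gamma_add_one hdn, Real.Gamma_add_one (by positivity),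
    Real.Gamma_add_one (by positivity)]
  field_simp

theorem momentMatrix_one {a b c d : ℝ} (ha : 0 < a) (hb : 0 < b)
    (hδ : 0 < c + d - a - b) (hc : ∀ m : ℕ, c ≠ -m) (hd : ∀ m : ℕ, d ≠ -m) (n : ℕ) :
    b * (c + n) * momentMatrix a b c d n 1 = c * (b + n) * momentMatrix a b c d n 0 := by
  have hc0 : c ≠ 0 := by simpa using hc 0
  have hc' : ∀ m : ℕ, c + n ≠ -m := fun m h => hc (n + m) (by push_cast; linarith)
  have hd' : ∀ m : ℕ, d + n ≠ -m := fun m h => hd (n + m) (by push_cast; linarith)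
  have hcn : c + n ≠ 0 := by simpa using hc' 0
  have g1 := (Real.Gamma_pos_of_pos ha).ne'
  have g2 := (Real.Gamma_pos_of_pos hb).ne'
  have g4 := Real.Gamma_ne_zero hc'
  have g5 := Real.Gamma_ne_zero hd'
  rw [momentMatrix_one_right hb hc0, momentMatrix_zero_right ha hb hδ hc hd,
    momentMatrix_zero_right ha (by linarith) (by linarith)
      (fun m h => hc (m + 1) (by push_cast; linarith)) hd, add_right_comm b, add_right_comm c,
    Real.Gamma_add_one hcn, Real.Gamma_add_one hc0, Real.Gamma_add_one (s := b) hb.ne',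
    Real.Gamma_add_one (s := b + n) (by positivity)]
  field_simp

/-- `Real.Gamma` takes the value 0 at its poles, so the constant in the density vanishes. -/
theorem momentMatrix_eq_zero {a b c d : ℝ} (h : (∃ m : ℕ, c = -m) ∨ ∃ m : ℕ, d = -m) :
    momentMatrix a b c d = 0 := by
  have : Real.Gamma c * Real.Gamma d = 0 := by
    rcases h with ⟨m, rfl⟩ | ⟨m, rfl⟩ <;> simp [Real.Gamma_neg_nat_eq_zero]
  ext n m
  simp [momentMatrix, density, this]

end

/-! ### Products of semi-infinite matrices with finite rows -/

/-- Every row has finitely many nonzero entries. -/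
def RowFinite (A : Matrix ℕ ℕ ℝ) : Prop :=
  ∀ n, ∃ N, ∀ m, N ≤ m → A n m = 0

theorem infMul_eq_sum_of_left {A : Matrix ℕ ℕ ℝ} {n N : ℕ} (h : ∀ m, N ≤ m → A n m = 0)
    (B : Matrix ℕ ℕ ℝ) (m : ℕ) :
    infMul A B n m = ∑ k ∈ Finset.range N, A n k * B k m :=
  tsum_eq_sum fun k hk => by rw [h k (by simpa using hk), zero_mul]

theorem infMul_eq_sum_of_right {B : Matrix ℕ ℕ ℝ} {m N : ℕ} (h : ∀ k, N ≤ k → B k m = 0)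
    (A : Matrix ℕ ℕ ℝ) (n : ℕ) :
    infMul A B n m = ∑ k ∈ Finset.range N, A n k * B k m :=
  tsum_eq_sum fun k hk => by rw [h k (by simpa using hk), mul_zero]

theorem RowFinite.infMul {A B : Matrix ℕ ℕ ℝ} (hA : RowFinite A) (hB : RowFinite B) :
    RowFinite (infMul A B) := by
  intro n
  obtain ⟨N, hN⟩ := hA n
  choose M hM using hB
  refine ⟨(Finset.range N).sup M, fun m hm => ?_⟩
  rw [infMul_eq_sum_of_left hN]
  refine Finset.sum_eq_zero fun k hk => ?_
  rw [hM k m ((Finset.le_sup hk).trans hm), mul_zero]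

theorem infMul_assoc {A B : Matrix ℕ ℕ ℝ} (hA : RowFinite A) (hB : RowFinite B)
    (C : Matrix ℕ ℕ ℝ) : infMul (infMul A B) C = infMul A (infMul B C) := by
  ext n m
  obtain ⟨N, hN⟩ := hA n
  choose M hM using hB
  have hAB : ∀ k, (Finset.range N).sup M ≤ k → infMul A B n k = 0 := fun k hk => by
    rw [infMul_eq_sum_of_left hN]
    exact Finset.sum_eq_zero fun i hi => by
      rw [hM i k ((Finset.le_sup hi).trans hk), mul_zero]
  rw [infMul_eq_sum_of_left hAB, infMul_eq_sum_of_left hN]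
  simp only [infMul_eq_sum_of_left hN, Finset.sum_mul]
  rw [Finset.sum_comm]
  refine Finset.sum_congr rfl fun i hi => ?_
  rw [infMul_eq_sum_of_left fun k hk => hM i k ((Finset.le_sup hi).trans hk), Finset.mul_sum]
  exact Finset.sum_congr rfl fun k _ => mul_assoc _ _ _

theorem infMul_one (A : Matrix ℕ ℕ ℝ) : infMul A 1 = A := by
  ext n m
  rw [infMul, tsum_eq_single m fun k hk => by rw [Matrix.one_apply_ne hk, mul_zero]]
  simp

theorem one_infMul (A : Matrix ℕ ℕ ℝ) : infMul 1 A = A := by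
  ext n m
  rw [infMul, tsum_eq_single n fun k hk => by rw [Matrix.one_apply_ne hk.symm, zero_mul]]
  simp

theorem infMul_zero (A : Matrix ℕ ℕ ℝ) : infMul A 0 = 0 := by
  ext n m
  simp [infMul]

theorem zero_infMul (A : Matrix ℕ ℕ ℝ) : infMul 0 A = 0 := by
  ext n m
  simp [infMul]

theorem shift_infMul (A : Matrix ℕ ℕ ℝ) (n m : ℕ) : infMul shift A n m = A (n + 1) m := by
  rw [infMul, tsum_eq_single (n + 1) fun k hk => by simp [shift, hk]]
  simp [shift]

theorem rowFinite_shift : RowFinite shift := fun n =>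
  ⟨n + 2, fun m hm => by simp only [shift]; rw [if_neg (by omega)]⟩

/-! ### Inverses of unitriangular matrices and the Gauss--Borel factorization -/

namespace IsLowerUnitriangular

variable {S R : Matrix ℕ ℕ ℝ}

theorem rowFinite (hS : IsLowerUnitriangular S) : RowFinite S := fun n =>
  ⟨n + 1, fun m hm => hS.2 n m (by omega)⟩

theorem infMul_apply (hS : IsLowerUnitriangular S) (B : Matrix ℕ ℕ ℝ) {n N : ℕ} (hN : n < N)
    (m : ℕ) : infMul S B n m = ∑ k ∈ Finset.range N, S n k * B k m :=
  infMul_eq_sum_of_left (fun k hk => hS.2 n k (by omega)) B m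

/-- The right inverse of a lower unitriangular matrix, by forward substitution. -/
def rightInverse (S : Matrix ℕ ℕ ℝ) : ℕ → ℕ → ℝ
  | n => fun m => (if m = n then 1 else 0) - ∑ k : Fin n, S n k * rightInverse S k m
  termination_by n => n
  decreasing_by exact k.2

theorem rightInverse_apply (S : Matrix ℕ ℕ ℝ) (n m : ℕ) : rightInverse S n m =
    (if m = n then 1 else 0) - ∑ k ∈ Finset.range n, S n k * rightInverse S k m := by
  conv_lhs => rw [rightInverse]
  rw [Finset.sum_range]

theorem exists_right_inverse (hS : IsLowerUnitriangular S) :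
    ∃ R, IsLowerUnitriangular R ∧ infMul S R = 1 := by
  have hlow : ∀ n m, n < m → rightInverse S n m = 0 := by
    intro n
    induction n using Nat.strong_induction_on with
    | _ n ih =>
      intro m hm
      rw [rightInverse_apply, if_neg hm.ne', Finset.sum_eq_zero, sub_zero]
      intro k hk
      have hk := Finset.mem_range.1 hk
      rw [ih k hk m (hk.trans hm), mul_zero]
  refine ⟨rightInverse S, ⟨fun n => ?_, hlow⟩, ?_⟩
  · rw [rightInverse_apply, if_pos rfl, Finset.sum_eq_zero, sub_zero]
    intro k hk
    rw [hlow k n (Finset.mem_range.1 hk), mul_zero]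
  · ext n m
    refine (hS.infMul_apply (rightInverse S) n.lt_succ_self m).trans ?_
    rw [Finset.sum_range_succ, hS.1, one_mul, rightInverse_apply S n m, Matrix.one_apply]
    simp [eq_comm]

theorem left_inverse_of_right_inverse (hS : IsLowerUnitriangular S) (hR : IsLowerUnitriangular R)
    (h : infMul S R = 1) : infMul R S = 1 := by
  obtain ⟨Q, hQ, hRQ⟩ := hR.exists_right_inverse
  have : S = Q := by
    rw [← infMul_one S, ← hRQ, ← infMul_assoc hS.rowFinite hR.rowFinite, h, one_infMul]
  rw [this, hRQ]

theorem exists_inverse (hS : IsLowerUnitriangular S) :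
    ∃ R, IsLowerUnitriangular R ∧ infMul S R = 1 ∧ infMul R S = 1 := by
  obtain ⟨R, hR, h⟩ := hS.exists_right_inverse
  exact ⟨R, hR, h, hS.left_inverse_of_right_inverse hR h⟩

end IsLowerUnitriangular

theorem infMul_transpose_apply {T : Matrix ℕ ℕ ℝ} (hT : IsLowerUnitriangular T)
    (U : Matrix ℕ ℕ ℝ) (n m : ℕ) :
    infMul U T.transpose n m = ∑ k ∈ Finset.range (m + 1), U n k * T m k :=
  infMul_eq_sum_of_right (B := T.transpose) (fun k hk => hT.2 m k (by omega)) U n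

/-- Right multiplication by `Tᵀ` only adds earlier columns to a column of `S g`; induction on the
column transfers the zeros and the diagonal of `H` to `S g`. -/
theorem IsGaussBorel.upper {g S T : Matrix ℕ ℕ ℝ} {H : ℕ → ℝ} (h : IsGaussBorel g S H T) :
    (∀ n m, m < n → infMul S g n m = 0) ∧ ∀ n, infMul S g n n = H n := by
  obtain ⟨-, hT, -, hg⟩ := h
  have hentry : ∀ n m, ∑ k ∈ Finset.range m, infMul S g n k * T m k + infMul S g n m =
      Matrix.diagonal H n m := fun n m => by
    rw [← hg, infMul_transpose_apply hT, Finset.sum_range_succ, hT.1, mul_one]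
  have hlow : ∀ n m, m < n → infMul S g n m = 0 := by
    intro n m
    induction m using Nat.strong_induction_on with
    | _ m ih =>
      intro hm
      have := hentry n m
      rwa [Finset.sum_eq_zero fun k hk => by
        have hk := Finset.mem_range.1 hk
        rw [ih k hk (hk.trans hm), zero_mul], zero_add, Matrix.diagonal_apply_ne _ hm.ne'] at this
  refine ⟨hlow, fun n => ?_⟩
  have := hentry n n
  rwa [Finset.sum_eq_zero fun k hk => by
    rw [hlow n k (Finset.mem_range.1 hk), zero_mul], zero_add, Matrix.diagonal_apply_eq] at this

/-! ### The return probabilities of a type I chain -/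

/-- For a matrix with at most one subdiagonal, the entries `(Pⁿ) k 0`. -/
def returnWeight (P : Matrix ℕ ℕ ℝ) : ℕ → ℕ → ℝ
  | 0, k => if k = 0 then 1 else 0
  | n + 1, k => ∑ j ∈ Finset.range (n + 1), P k j * returnWeight P n j

theorem IsTypeIMatrix.ne_neg_nat {a b c d : ℝ} {P : Matrix ℕ ℕ ℝ}
    (h : IsTypeIMatrix a b c d P) : (∀ m : ℕ, c ≠ -m) ∧ ∀ m : ℕ, d ≠ -m := by
  obtain ⟨-, -, -, S, H, T, J, ⟨-, -, hH, hg⟩, -⟩ := h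
  by_contra hcon
  have h0 : momentMatrix a b c d = 0 := momentMatrix_eq_zero (by
    by_contra! h'
    exact hcon h')
  rw [h0, infMul_zero, zero_infMul] at hg
  have := congrFun (congrFun hg 0) 0
  rw [Matrix.diagonal_apply_eq] at this
  exact hH 0 this.symm

theorem IsTypeIStochasticMatrix.moments {a b c d : ℝ} {P : Matrix ℕ ℕ ℝ}
    (h : IsTypeIStochasticMatrix a b c d P) :
    (∀ n, momentMatrix a b c d n 0 = returnWeight P n 0) ∧
      (∃ t ≠ 0, ∀ n, momentMatrix a b c d n 1 = returnWeight P n 0 + t * returnWeight P n 1) ∧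
      returnWeight P 1 1 ≠ 0 ∧ P 0 2 ≠ 0 := by
  obtain ⟨hI, hst⟩ := h
  obtain ⟨hc, hd⟩ := hI.ne_neg_nat
  obtain ⟨ha, hb, hδ, S, H, T, J, hGB, ⟨R, hR, hSR, hJ⟩, hP⟩ := hI
  obtain ⟨hUlow, hUdiag⟩ := hGB.upper
  obtain ⟨hS, hT, hH, -⟩ := hGB
  set g := momentMatrix a b c d with hg
  set q : ℕ → ℝ := fun n => linearForm a b c d H T n 1 with hq
  have hRS := hS.left_inverse_of_right_inverse hR hSR
  -- As division by 0 gives 0, `q n = 0` would make row `n` of `P` zero, against its unit sum.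
  have hq0 : ∀ n, q n ≠ 0 := by
    intro n hn
    have h0 : P n = 0 := by
      ext m
      rw [hP]
      change q m / q n * _ = 0
      rw [hn, div_zero, zero_mul]
    have := hst.2 n
    rw [h0] at this
    exact zero_ne_one (hasSum_zero.unique this)
  have hPJ : ∀ k j, P k j = q j / q k * J j k := hP
  have hRJ : infMul R J = infMul shift R := by
    rw [hJ, ← infMul_assoc hR.rowFinite (hS.rowFinite.infMul rowFinite_shift),
      ← infMul_assoc hR.rowFinite hS.rowFinite, hRS, one_infMul]
  have hrec : ∀ n k, R (n + 1) k = ∑ j ∈ Finset.range (n + 1), R n j * J j k := fun n k => by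
    rw [← shift_infMul R n k, ← hRJ, hR.infMul_apply _ n.lt_succ_self]
  have hx : ∀ n k, returnWeight P n k = q 0 * R n k / q k := by
    intro n
    induction n with
    | zero =>
      intro k
      rcases Nat.eq_zero_or_pos k with rfl | hk
      · simp [returnWeight, hR.1, hq0 0]
      · simp [returnWeight, hR.2 0 k hk, hk.ne']
    | succ n ih =>
      intro k
      rw [returnWeight, hrec, Finset.mul_sum, Finset.sum_div]
      refine Finset.sum_congr rfl fun j _ => ?_
      rw [ih, hPJ]
      have := hq0 j
      field_simp
  have hgRU : g = infMul R (infMul S g) := by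
    rw [← infMul_assoc hR.rowFinite hS.rowFinite, hRS, one_infMul]
  have hg0 : ∀ n, g n 0 = R n 0 * H 0 := fun n => by
    rw [hgRU, hR.infMul_apply _ n.lt_succ_self, Finset.sum_eq_single 0, hUdiag]
    · intro k _ hk
      rw [hUlow k 0 (Nat.pos_of_ne_zero hk), mul_zero]
    · simp
  have hg1 : ∀ n, g n 1 = R n 0 * infMul S g 0 1 + R n 1 * H 1 := fun n => by
    conv_lhs => rw [hgRU]
    rw [hR.infMul_apply _ (show n < n + 2 by omega), Finset.sum_range_succ', Finset.sum_range_succ',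
      Finset.sum_eq_zero, zero_add, hUdiag, add_comm]
    intro k _
    rw [hUlow _ 1 (by omega), mul_zero]
  have hg00 : g 0 0 = 1 := momentMatrix_zero_zero ha hb hδ hc hd
  have hH0 : H 0 = 1 := by simpa [hR.1, hg00] using (hg0 0).symm
  have hR0 : ∀ n, R n 0 = returnWeight P n 0 := fun n => by
    rw [hx, mul_comm, mul_div_cancel_right₀ _ (hq0 0)]
  have hR1 : ∀ n, R n 1 = q 1 / q 0 * returnWeight P n 1 := fun n => by
    have := hq0 0
    have := hq0 1
    rw [hx]
    field_simp
  have hc0 : c ≠ 0 := by simpa using hc 0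
  have hg01 : g 0 1 = 1 := by
    have := momentMatrix_one ha hb hδ hc hd 0
    rw [← hg, hg00] at this
    have hbc : b * c ≠ 0 := mul_ne_zero hb.ne' hc0
    refine mul_left_cancel₀ hbc ?_
    simp only [Nat.cast_zero, add_zero] at this
    linear_combination this
  have hU01 : infMul S g 0 1 = 1 := by
    have := hg1 0
    rw [hg01, hR.1, hR.2 0 1 one_pos] at this
    linarith
  refine ⟨fun n => by rw [hg0, hH0, mul_one, hR0], ⟨q 1 / q 0 * H 1,
    mul_ne_zero (div_ne_zero (hq0 1) (hq0 0)) (hH 1), fun n => ?_⟩, ?_, ?_⟩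
  · rw [hg1, hU01, hR0, hR1]
    ring
  · rw [hx, hR.1, mul_one]
    exact div_ne_zero (hq0 0) (hq0 1)
  -- Moving two columns to the right in `g` is moving one row down, and column 0 of `g` is column 0
  -- of `R`. Hence column 0 of `J = S (Λ R)` is column 2 of `S g`.
  · have hJ20 : J 2 0 = H 2 := by
      have hSJ : J = infMul S (infMul R J) := by
        rw [← infMul_assoc hS.rowFinite hR.rowFinite, hSR, one_infMul]
      rw [← hUdiag 2, hSJ, hS.infMul_apply _ (Nat.lt_succ_self 2),
        hS.infMul_apply _ (Nat.lt_succ_self 2)]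
      refine Finset.sum_congr rfl fun k _ => ?_
      rw [hRJ, shift_infMul, hg, momentMatrix_add_two, ← hg, hg0, hH0, mul_one]
    rw [hPJ, hJ20]
    exact mul_ne_zero (div_ne_zero (hq0 2) (hq0 0)) (hH 2)

/-- The relation between the return probabilities to `0` from the states `0` and `1`. -/
theorem IsTypeIStochasticMatrix.returnWeight_relation {a b c d : ℝ} {P : Matrix ℕ ℕ ℝ}
    (h : IsTypeIStochasticMatrix a b c d P) :
    ∃ B : ℝ, B ≠ 0 ∧ ∀ n : ℕ, (c + n) * B * returnWeight P n 1 = n * returnWeight P n 0 := by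
  obtain ⟨hc, hd⟩ := h.1.ne_neg_nat
  obtain ⟨h0, ⟨t, ht, h1⟩, h11, -⟩ := h.moments
  obtain ⟨ha, hb, hδ, -⟩ := h.1
  have key : ∀ n : ℕ, b * (c + n) * (t * returnWeight P n 1) =
      (c - b) * (n * returnWeight P n 0) := fun n => by
    have := momentMatrix_one ha hb hδ hc hd n
    rw [h0, h1] at this
    linear_combination this
  -- If `c = b`, the relation at `n = 1` would force `returnWeight P 1 1 = 0`.
  have hcb : c - b ≠ 0 := by
    intro hcb
    have := key 1
    rw [hcb, zero_mul] at this
    have hc1 : c + (1 : ℕ) ≠ 0 := fun h => hc 1 (by push_cast at h ⊢; linarith)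
    exact mul_ne_zero (mul_ne_zero hb.ne' hc1) (mul_ne_zero ht h11) this
  refine ⟨b * t / (c - b), div_ne_zero (mul_ne_zero hb.ne' ht) hcb, fun n => ?_⟩
  field_simp
  linear_combination key n

/-! ### Classification of the uniform type I chains -/

/-- The matrix with row `0` equal to `(p₀, p₁, p₂, 0, …)` and all other rows given by the
coefficients of `(l / w + 1 - l) (p₀ + p₁ w + p₂ w²)`. -/
def bandMatrix (l p₀ p₁ p₂ : ℝ) : Matrix ℕ ℕ ℝ := fun n m =>
  if n = 0 then
    (if m = 0 then p₀ else if m = 1 then p₁ else if m = 2 then p₂ else 0)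
  else if m + 1 = n then l * p₀ else if m = n then l * p₁ + (1 - l) * p₀
  else if m = n + 1 then l * p₂ + (1 - l) * p₁ else if m = n + 2 then (1 - l) * p₂ else 0

theorem uniformMatrix_eq_bandMatrix :
    uniformMatrix = bandMatrix (2 / 3) (4 / 9) (4 / 9) (1 / 9) := by
  ext n m
  simp only [uniformMatrix, bandMatrix]
  norm_num

/-- Lagrange inversion to fifth order: the relation `(A + n B) xₙ(1) = n l p₀ xₙ(0)` between the
return probabilities determines the coefficients of a polynomial identity. -/
theorem bandMatrix_coefficients {l p₀ p₁ p₂ A B : ℝ} (hl : l ≠ 0) (hp : p₀ ≠ 0)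
    (h : ∀ n : ℕ, (A + n * B) * returnWeight (bandMatrix l p₀ p₁ p₂) n 1 =
      n * (l * p₀) * returnWeight (bandMatrix l p₀ p₁ p₂) n 0) :
    A + B = p₀ ∧ A * l * (p₀ + p₁) = 2 * B * (1 - l) * p₀ ∧
    -A * (l * p₂ + (1 - l) * p₁) - p₂ * l * A + 2 * B * (1 - l) * p₁ - B * (1 - l) * p₀ = 0 ∧
    A * (l * p₂ + (1 - l) * p₁) - 2 * A * (1 - l) * p₂ + 2 * B * (1 - l) * p₂
      - B * (1 - l) * p₁ = 0 ∧
    2 * A * (1 - l) * p₂ = B * (1 - l) * p₂ := by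
  have d1 := h 1
  have d2 := h 2
  have d3 := h 3
  have d4 := h 4
  have d5 := h 5
  -- The coefficients of `s(w) p(w)`, where `s = l + (1-l)w` and `p = p₀ + p₁w + p₂w²`; the
  -- first-passage series solves `w = z s(w) p(w)`.
  obtain ⟨q₀, hq₀⟩ : ∃ q, q = l * p₀ := ⟨_, rfl⟩
  obtain ⟨q₁, hq₁⟩ : ∃ q, q = l * p₁ + (1 - l) * p₀ := ⟨_, rfl⟩
  obtain ⟨q₂, hq₂⟩ : ∃ q, q = l * p₂ + (1 - l) * p₁ := ⟨_, rfl⟩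
  obtain ⟨q₃, hq₃⟩ : ∃ q, q = (1 - l) * p₂ := ⟨_, rfl⟩
  simp only [returnWeight, Finset.sum_range_succ, Finset.sum_range_zero, bandMatrix] at d1 d2 d3 d4 d5
  norm_num [← hq₀, ← hq₁, ← hq₂, ← hq₃] at d1 d2 d3 d4 d5
  have hq : q₀ ≠ 0 := hq₀ ▸ mul_ne_zero hl hp
  have e0 : A + B = p₀ := mul_right_cancel₀ hq (by linear_combination d1)
  -- With `A + B = p₀` inserted, `eᵢ` is the coefficient of `wⁱ` in `A(1-w)(l p - w s p') + B p
  -- (s(1-w) + w) - l p₀ p`.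
  obtain ⟨e₁, he₁⟩ : ∃ e, e = -A * l * (p₀ + p₁) + 2 * B * (1 - l) * p₀ := ⟨_, rfl⟩
  obtain ⟨e₂, he₂⟩ : ∃ e, e = -A * (l * p₂ + (1 - l) * p₁) - p₂ * l * A +
    2 * B * (1 - l) * p₁ - B * (1 - l) * p₀ := ⟨_, rfl⟩
  obtain ⟨e₃, he₃⟩ : ∃ e, e = A * (l * p₂ + (1 - l) * p₁) - 2 * A * (1 - l) * p₂ +
    2 * B * (1 - l) * p₂ - B * (1 - l) * p₁ := ⟨_, rfl⟩
  obtain ⟨e₄, he₄⟩ : ∃ e, e = 2 * A * (1 - l) * p₂ - B * (1 - l) * p₂ := ⟨_, rfl⟩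
  obtain rfl : A = p₀ - B := by linarith
  -- `q₀, f₂, f₃, f₄` are the coefficients of `z, …, z⁴` in `w(z)`, and `l, g₁, g₂, g₃` those of `1,
  -- …, z³` in `s(w) / (1-w)²`.
  obtain ⟨f₂, hf₂⟩ : ∃ f, f = q₀ * q₁ := ⟨_, rfl⟩
  obtain ⟨f₃, hf₃⟩ : ∃ f, f = q₀ * q₁ ^ 2 + q₀ ^ 2 * q₂ := ⟨_, rfl⟩
  obtain ⟨f₄, hf₄⟩ : ∃ f, f = q₀ * q₁ ^ 3 + 3 * q₀ ^ 2 * q₁ * q₂ + q₀ ^ 3 * q₃ := ⟨_, rfl⟩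
  obtain ⟨g₁, hg₁⟩ : ∃ g, g = (1 + l) * q₀ := ⟨_, rfl⟩
  obtain ⟨g₂, hg₂⟩ : ∃ g, g = (1 + l) * f₂ + (2 + l) * q₀ ^ 2 := ⟨_, rfl⟩
  obtain ⟨g₃, hg₃⟩ : ∃ g, g = (1 + l) * f₃ + 2 * (2 + l) * q₀ * f₂ + (3 + l) * q₀ ^ 3 := ⟨_, rfl⟩
  -- The relation at `n`, times `l`, is the coefficient of `zⁿ⁻²` in `w'(z) · s(w)/(1-w)² · (e₁ +
  -- e₂w + e₃w² + e₄w³)`. The system is triangular with diagonal `l q₀ⁿ⁻¹`.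
  have c2 : q₀ * l * e₁ = 0 := by
    rw [he₁]
    subst hq₀ hq₁ hq₂ hq₃
    linear_combination l * d2
  have c3 : (q₀ * g₁ + 2 * f₂ * l) * e₁ + q₀ ^ 2 * l * e₂ = 0 := by
    rw [he₁, he₂, hg₁, hf₂]
    subst hq₀ hq₁ hq₂ hq₃
    linear_combination l * d3
  have c4 : (q₀ * g₂ + 2 * f₂ * g₁ + 3 * f₃ * l) * e₁ + (q₀ ^ 2 * g₁ + 3 * q₀ * f₂ * l) * e₂ +
      q₀ ^ 3 * l * e₃ = 0 := by
    rw [he₁, he₂, he₃, hg₁, hg₂, hf₂, hf₃]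
    subst hq₀ hq₁ hq₂ hq₃
    linear_combination l * d4
  have c5 : (q₀ * g₃ + 2 * f₂ * g₂ + 3 * f₃ * g₁ + 4 * f₄ * l) * e₁ +
      (q₀ ^ 2 * g₂ + 3 * q₀ * f₂ * g₁ + 2 * (f₂ ^ 2 + 2 * q₀ * f₃) * l) * e₂ +
      (q₀ ^ 3 * g₁ + 4 * q₀ ^ 2 * f₂ * l) * e₃ + q₀ ^ 4 * l * e₄ = 0 := by
    rw [he₁, he₂, he₃, he₄, hg₁, hg₂, hg₃, hf₂, hf₃, hf₄]
    subst hq₀ hq₁ hq₂ hq₃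
    linear_combination l * d5
  have z1 : e₁ = 0 := by simpa [hq, hl] using c2
  have z2 : e₂ = 0 := by simpa [hq, hl, z1] using c3
  have z3 : e₃ = 0 := by simpa [hq, hl, z1, z2] using c4
  have z4 : e₄ = 0 := by simpa [hq, hl, z1, z2, z3] using c5
  rw [z1] at he₁
  exact ⟨e0, by linarith, by rw [← he₂, z2], by rw [← he₃, z3], by linarith⟩

/-- The uniform type I chains with stochastic rows. -/
theorem bandMatrix_unique {l p₀ p₁ p₂ A B : ℝ} (hl : l ≠ 0) (hp : p₀ ≠ 0) (hp₂ : p₂ ≠ 0)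
    (hA : A ≠ 0) (hsum : p₀ + p₁ + p₂ = 1)
    (h : ∀ n : ℕ, (A + n * B) * returnWeight (bandMatrix l p₀ p₁ p₂) n 1 =
      n * (l * p₀) * returnWeight (bandMatrix l p₀ p₁ p₂) n 0) :
    l = 2 / 3 ∧ p₀ = 4 / 9 ∧ p₁ = 4 / 9 ∧ p₂ = 1 / 9 ∧ B = 2 * A := by
  obtain ⟨h0, h1, h2, h3, h4⟩ := bandMatrix_coefficients hl hp h
  -- The value of the polynomial identity at `w = 1`, where `p(1) = 1`.
  have hB : B = l * p₀ := by
    linear_combination l * (p₀ + p₁ + p₂) * h0 - h1 + h2 + h3 + h4 - (B - l * p₀) * hsum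
  have hl1 : l ≠ 1 := by
    rintro rfl
    have : p₀ + p₁ = 0 := by simpa [hA] using h1
    have : A * p₂ = 0 := by linear_combination -(1 / 2) * h2
    exact mul_ne_zero hA hp₂ this
  have hBA : B = 2 * A := by
    have : (1 - l) * p₂ ≠ 0 := mul_ne_zero (sub_ne_zero.2 hl1.symm) hp₂
    refine mul_right_cancel₀ this ?_
    linear_combination -h4
  subst hBA
  obtain rfl : p₀ = 3 * A := by linarith
  obtain rfl : l = 2 / 3 := mul_right_cancel₀ hA (by linear_combination -(1 / 3) * hB)
  obtain rfl : p₁ = 3 * A := mul_left_cancel₀ hA (by linear_combination (3 / 2) * h1)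
  have h4 : 4 * p₂ = 3 * A := mul_left_cancel₀ hA (by linear_combination -3 * h2)
  refine ⟨rfl, ?_, ?_, ?_, rfl⟩ <;> linarith

theorem IsStochastic.sum_row {P : Matrix ℕ ℕ ℝ} (hP : IsStochastic P) {n N : ℕ}
    (h : ∀ m, N ≤ m → P n m = 0) : ∑ m ∈ Finset.range N, P n m = 1 :=
  (hasSum_sum_of_ne_finset_zero fun m hm => h m (by simpa using hm)).unique (hP.2 n)

theorem IsTypeIStochasticMatrix.eq_of_bandMatrix {a b c d l p₀ p₁ p₂ : ℝ}
    (h : IsTypeIStochasticMatrix a b c d (bandMatrix l p₀ p₁ p₂)) :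
    (l = 2 / 3 ∧ p₀ = 4 / 9 ∧ p₁ = 4 / 9 ∧ p₂ = 1 / 9) ∧ c = 1 / 2 := by
  obtain ⟨-, -, h11, h02⟩ := h.moments
  obtain ⟨B, hB, hrel⟩ := h.returnWeight_relation
  obtain ⟨hc, -⟩ := h.1.ne_neg_nat
  have hc0 : c ≠ 0 := by simpa using hc 0
  have hlp : l * p₀ ≠ 0 := by simpa [returnWeight, bandMatrix] using h11
  have hp2 : p₂ ≠ 0 := by simpa [bandMatrix] using h02
  have hsum : p₀ + p₁ + p₂ = 1 := by
    have := h.2.sum_row (n := 0) (N := 3) fun m hm => by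
      simp only [bandMatrix, if_true]
      rw [if_neg (by omega), if_neg (by omega), if_neg (by omega)]
    simpa [Finset.sum_range_succ, bandMatrix] using this
  obtain ⟨hl, hp⟩ := mul_ne_zero_iff.1 hlp
  -- The relation is scaled by `l p₀` to match the right-hand side; then `A = c B`, and `B = 2A`
  -- gives `c = 1/2`.
  obtain ⟨h1, h2, h3, h4, h5⟩ := bandMatrix_unique (A := c * (B * (l * p₀))) (B := B * (l * p₀))
    hl hp hp2 (mul_ne_zero hc0 (mul_ne_zero hB hlp)) hsum
    (fun n => by linear_combination (l * p₀) * hrel n)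
  refine ⟨⟨h1, h2, h3, h4⟩, mul_right_cancel₀ (mul_ne_zero hB hlp) ?_⟩
  linear_combination -(1 / 2) * h5

theorem IsTypeIStochasticMatrix.tuple_eq {a b c d : ℝ}
    (h : IsTypeIStochasticMatrix a b c d uniformMatrix) :
    (a = 1 / 3 ∧ b = 2 / 3 ∧ c = 1 / 2 ∧ d = 1) ∨
      (a = 2 / 3 ∧ b = 1 / 3 ∧ c = 1 / 2 ∧ d = 1) := by
  obtain ⟨hc, hd⟩ := h.1.ne_neg_nat
  have hm := h.moments.1
  obtain ⟨ha, hb, hδ, -⟩ := h.1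
  rw [uniformMatrix_eq_bandMatrix] at h
  obtain ⟨-, rfl⟩ := h.eq_of_bandMatrix
  have hrec := momentMatrix_succ_zero ha hb hδ hc hd
  simp only [hm] at hrec
  have r0 := hrec 0
  have r1 := hrec 1
  have r2 := hrec 2
  simp only [returnWeight, Finset.sum_range_succ, Finset.sum_range_zero, uniformMatrix] at r0 r1 r2
  norm_num at r0 r1 r2
  -- The three equations are linear in `d`, `a + b` and `ab`.
  have hd1 : d = 1 := by
    nlinarith [r0, r1, r2]
  subst hd1
  have hab : a + b = 1 := by nlinarith [r0, r1]
  obtain rfl : b = 1 - a := by linarith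
  have : (a - 1 / 3) * (a - 2 / 3) = 0 := by nlinarith [r0]
  rcases mul_eq_zero.1 this with h' | h'
  · exact Or.inl ⟨by linarith, by linarith, rfl, rfl⟩
  · exact Or.inr ⟨by linarith, by linarith, rfl, rfl⟩

/-! ### Uniform factorizations -/

theorem IsUniformBirth.entries {U : Matrix ℕ ℕ ℝ} (hU : IsUniformBirth U) (n m : ℕ) :
    U n m = if m = n then 1 - U 0 1 else if m = n + 1 then U 0 1 else 0 := by
  obtain ⟨⟨hst, hzero⟩, htoep⟩ := hU
  have h0 : U 0 0 + U 0 1 = 1 := by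
    have := hst.sum_row (n := 0) (N := 2) fun m hm => hzero 0 m (by omega) (by omega)
    simpa [Finset.sum_range_succ] using this
  have hdiag : ∀ n, U n n = U 0 0 := fun n => by
    induction n with
    | zero => rfl
    | succ n ih => rw [htoep, ih]
  have hsup : ∀ n, U n (n + 1) = U 0 1 := fun n => by
    induction n with
    | zero => rfl
    | succ n ih => rw [htoep, ih]
  split_ifs with h1 h2
  · rw [h1, hdiag]; linarith
  · rw [h2, hsup]
  · exact hzero n m h1 h2

theorem IsUniformDeath.entries {L : Matrix ℕ ℕ ℝ} (hL : IsUniformDeath L) (n m : ℕ) :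
    L n m = if n = 0 then (if m = 0 then 1 else 0)
      else if m + 1 = n then L 1 0 else if m = n then 1 - L 1 0 else 0 := by
  obtain ⟨⟨hst, hzero⟩, htoep⟩ := hL
  have h0 : L 0 0 = 1 := by
    have := hst.sum_row (n := 0) (N := 1) fun m hm => hzero 0 m (by omega) (by omega)
    simpa [Finset.sum_range_succ] using this
  have h1 : L 1 0 + L 1 1 = 1 := by
    have := hst.sum_row (n := 1) (N := 2) fun m hm => hzero 1 m (by omega) (by omega)
    simpa [Finset.sum_range_succ] using this
  have hdiag : ∀ n, L (n + 1) (n + 1) = L 1 1 := fun n => by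
    induction n with
    | zero => rfl
    | succ n ih => rw [htoep _ _ (by omega), ih]
  have hsub : ∀ n, L (n + 1) n = L 1 0 := fun n => by
    induction n with
    | zero => rfl
    | succ n ih => rw [htoep _ _ (by omega), ih]
  rcases n with _ | n
  · rw [if_pos rfl]
    split_ifs with h
    · rw [h, h0]
    · exact hzero 0 m h (by omega)
  · rw [if_neg (by omega)]
    split_ifs with h2 h3
    · obtain rfl : m = n := by omega
      exact hsub m
    · rw [h3, hdiag]; linarith
    · exact hzero _ m h3 h2

theorem infMul_eq_of_birth {A U : Matrix ℕ ℕ ℝ} {u : ℝ}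
    (hU : ∀ n m, U n m = if m = n then 1 - u else if m = n + 1 then u else 0) (n m : ℕ) :
    infMul A U n m = A n m * (1 - u) + if m = 0 then 0 else A n (m - 1) * u := by
  rw [infMul_eq_sum_of_right (N := m + 1) (fun k hk => by
    rw [hU, if_neg (by omega), if_neg (by omega)]), Finset.sum_range_succ, hU m m, if_pos rfl,
    add_comm]
  congr 1
  rcases m with _ | m
  · simp
  · rw [if_neg (by omega), Finset.sum_range_succ, hU m, if_neg (by omega), if_pos rfl,
      Finset.sum_eq_zero, zero_add, Nat.add_sub_cancel]
    intro k hk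
    have := Finset.mem_range.1 hk
    rw [hU, if_neg (by omega), if_neg (by omega), mul_zero]

theorem uniform_product_eq_bandMatrix {L U₂ U₁ : Matrix ℕ ℕ ℝ} {l u₂ u₁ : ℝ}
    (hL : ∀ n m, L n m = if n = 0 then (if m = 0 then 1 else 0)
      else if m + 1 = n then l else if m = n then 1 - l else 0)
    (hU₂ : ∀ n m, U₂ n m = if m = n then 1 - u₂ else if m = n + 1 then u₂ else 0)
    (hU₁ : ∀ n m, U₁ n m = if m = n then 1 - u₁ else if m = n + 1 then u₁ else 0) :
    infMul (infMul L U₂) U₁ = bandMatrix l ((1 - u₂) * (1 - u₁))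
      (u₂ * (1 - u₁) + (1 - u₂) * u₁) (u₂ * u₁) := by
  ext n m
  simp only [infMul_eq_of_birth hU₁, infMul_eq_of_birth hU₂]
  rcases n with _ | n
  · rcases m with _ | _ | _ | m
    · simp [hL, bandMatrix]
    · simp [hL, bandMatrix]
    · simp [hL, bandMatrix]
    · simp [hL, bandMatrix]
  · rcases m with _ | _ | m
    · simp only [hL, bandMatrix]
      split_ifs <;> first | omega | ring
    · simp only [hL, bandMatrix]
      split_ifs <;> first | omega | ring
    · simp only [hL, bandMatrix]
      split_ifs <;> first | omega | ring

theorem IsUniformStochasticFactorization.eq_bandMatrix {P L U₂ U₁ : Matrix ℕ ℕ ℝ}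
    (h : IsUniformStochasticFactorization P L U₂ U₁) :
    P = bandMatrix (L 1 0) ((1 - U₂ 0 1) * (1 - U₁ 0 1))
      (U₂ 0 1 * (1 - U₁ 0 1) + (1 - U₂ 0 1) * U₁ 0 1) (U₂ 0 1 * U₁ 0 1) := by
  obtain ⟨hL, h2, h1, rfl⟩ := h
  exact uniform_product_eq_bandMatrix hL.entries h2.entries h1.entries

theorem isUniformBirth_birthFactor : IsUniformBirth birthFactor := by
  refine ⟨⟨⟨fun n m => ?_, fun n => ?_⟩, fun n m h1 h2 => ?_⟩, fun n m => ?_⟩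
  · simp only [birthFactor]
    split_ifs <;> norm_num
  · have : HasSum (birthFactor n) _ := hasSum_sum_of_ne_finset_zero (s := {n, n + 1}) (fun m hm => by
      simp only [Finset.mem_insert, Finset.mem_singleton, not_or] at hm
      simp [birthFactor, hm.1, hm.2])
    convert this using 1
    simp [birthFactor]
    norm_num
  · simp [birthFactor, h1, h2]
  · simp [birthFactor]

theorem isUniformDeath_deathFactor : IsUniformDeath deathFactor := by
  refine ⟨⟨⟨fun n m => ?_, fun n => ?_⟩, fun n m h1 h2 => ?_⟩, fun n m hn => ?_⟩
  · simp only [deathFactor]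
    split_ifs <;> norm_num
  · rcases n with _ | n
    · have : HasSum (deathFactor 0) _ := hasSum_sum_of_ne_finset_zero (s := {0}) (fun m hm => by
        simp only [Finset.mem_singleton] at hm
        simp [deathFactor, hm])
      convert this using 1
      simp [deathFactor]
    · have : HasSum (deathFactor (n + 1)) _ := hasSum_sum_of_ne_finset_zero (s := {n, n + 1})
        (fun m hm => by
          simp only [Finset.mem_insert, Finset.mem_singleton, not_or] at hm
          simp [deathFactor, hm.1, hm.2])
      convert this using 1
      simp [deathFactor]
      norm_num
  · simp only [deathFactor]
    rw [if_neg h2, if_neg h1]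
    split_ifs <;> first | omega | rfl
  · have : n ≠ 0 := by omega
    simp [deathFactor, this]

theorem isUniformStochasticFactorization_uniformMatrix :
    IsUniformStochasticFactorization uniformMatrix deathFactor birthFactor birthFactor := by
  refine ⟨isUniformDeath_deathFactor, isUniformBirth_birthFactor, isUniformBirth_birthFactor, ?_⟩
  have hb : ∀ n m, birthFactor n m =
      if m = n then 1 - 1 / 3 else if m = n + 1 then 1 / 3 else 0 := fun n m => by
    simp only [birthFactor]
    norm_num
  rw [uniform_product_eq_bandMatrix (l := 2 / 3) (fun n m => by
    simp only [deathFactor]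
    norm_num) hb hb, uniformMatrix_eq_bandMatrix]
  norm_num

theorem IsUniformStochasticFactorization.eq_of_uniformMatrix {L U₂ U₁ : Matrix ℕ ℕ ℝ}
    (h : IsUniformStochasticFactorization uniformMatrix L U₂ U₁) :
    L = deathFactor ∧ U₂ = birthFactor ∧ U₁ = birthFactor := by
  have hP := h.eq_bandMatrix
  obtain ⟨hL, h2, h1, -⟩ := h
  have e0 := congrFun (congrFun hP 0) 0
  have e1 := congrFun (congrFun hP 0) 1
  have e2 := congrFun (congrFun hP 0) 2
  have e3 := congrFun (congrFun hP 1) 0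
  simp only [uniformMatrix, bandMatrix] at e0 e1 e2 e3
  norm_num at e0 e1 e2 e3
  have hsum : U₂ 0 1 + U₁ 0 1 = 2 / 3 := by nlinarith
  -- The two birth probabilities have sum `2/3` and product `1/9`, so both are the double root
  -- `1/3`.
  have hsq : (U₂ 0 1 - 1 / 3) ^ 2 = 0 := by
    have : U₁ 0 1 = 2 / 3 - U₂ 0 1 := by linarith
    rw [this] at e2
    linarith
  have hu2 : U₂ 0 1 = 1 / 3 := by
    have := pow_eq_zero_iff (two_ne_zero) |>.1 hsq
    linarith
  have hu1 : U₁ 0 1 = 1 / 3 := by linarith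
  have hl : L 1 0 = 2 / 3 := by
    rw [hu2, hu1] at e3
    linarith
  refine ⟨?_, ?_, ?_⟩
  · ext n m
    rw [hL.entries, hl, deathFactor]
    norm_num
  · ext n m
    rw [h2.entries, hu2, birthFactor]
    norm_num
  · ext n m
    rw [h1.entries, hu1, birthFactor]
    norm_num

/-! ### The uniform matrix is a type I matrix -/

theorem uniformMatrix_zero_sum {N : ℕ} (hN : 3 ≤ N) (f : ℕ → ℝ) :
    ∑ j ∈ Finset.range N, uniformMatrix 0 j * f j =
      12 / 27 * f 0 + 12 / 27 * f 1 + 3 / 27 * f 2 := by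
  have h : ∀ j, uniformMatrix 0 j * f j = (if j = 0 then 12 / 27 * f j else 0) +
      (if j = 1 then 12 / 27 * f j else 0) + (if j = 2 then 3 / 27 * f j else 0) := fun j => by
    rcases j with _ | _ | _ | j <;> simp [uniformMatrix]
  simp only [h, Finset.sum_add_distrib, Finset.sum_ite_eq', Finset.mem_range]
  rw [if_pos (by omega), if_pos (by omega), if_pos (by omega)]

theorem uniformMatrix_succ_sum {i N : ℕ} (hN : i + 4 ≤ N) (f : ℕ → ℝ) :
    ∑ j ∈ Finset.range N, uniformMatrix (i + 1) j * f j =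
      8 / 27 * f i + 12 / 27 * f (i + 1) + 6 / 27 * f (i + 2) + 1 / 27 * f (i + 3) := by
  have h : ∀ j, uniformMatrix (i + 1) j * f j = (if j = i then 8 / 27 * f j else 0) +
      (if j = i + 1 then 12 / 27 * f j else 0) + (if j = i + 2 then 6 / 27 * f j else 0) +
      (if j = i + 3 then 1 / 27 * f j else 0) := fun j => by
    simp only [uniformMatrix, Nat.add_right_cancel_iff]
    rw [if_neg (Nat.succ_ne_zero i)]
    split_ifs <;> first | omega | ring1
  simp only [h, Finset.sum_add_distrib, Finset.sum_ite_eq', Finset.mem_range]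
  rw [if_pos (by omega), if_pos (by omega), if_pos (by omega), if_pos (by omega)]

theorem uniformMatrix_eq_zero {n m : ℕ} (h : n + 3 ≤ m) : uniformMatrix n m = 0 := by
  simp only [uniformMatrix]
  split_ifs <;> first | omega | rfl

theorem isStochastic_uniformMatrix : IsStochastic uniformMatrix := by
  refine ⟨fun n m => ?_, fun n => ?_⟩
  · simp only [uniformMatrix]
    split_ifs <;> norm_num
  · have h : HasSum (uniformMatrix n) (∑ m ∈ Finset.range (n + 3), uniformMatrix n m) :=
      hasSum_sum_of_ne_finset_zero fun m hm => uniformMatrix_eq_zero (by simpa using hm)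
    convert h using 1
    rcases n with _ | i
    · have := uniformMatrix_zero_sum (N := 0 + 3) le_rfl fun _ => 1
      simp only [mul_one] at this
      rw [this]
      norm_num
    · have := uniformMatrix_succ_sum (i := i) (N := i + 1 + 3) le_rfl fun _ => 1
      simp only [mul_one] at this
      rw [this]
      norm_num

/-- The probability of being in `0` after `n` steps of the uniform chain started in `j`. -/
def ballot (n j : ℕ) : ℝ := 2 ^ j * (4 / 27) ^ n * ((3 * n).choose (2 * n + j) : ℝ)

theorem ballot_eq_zero {n j : ℕ} (h : n < j) : ballot n j = 0 := by
  rw [ballot, Nat.choose_eq_zero_of_lt (by omega), Nat.cast_zero, mul_zero]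

theorem choose_three_mul (m k : ℕ) : (m + 3).choose (k + 3) =
    m.choose k + 3 * m.choose (k + 1) + 3 * m.choose (k + 2) + m.choose (k + 3) := by
  simp only [Nat.choose_succ_succ']
  ring

/-- Away from the boundary the symbol is `(2 + w)³ / (27 w)`, so the recursion is Pascal's rule
applied three times. Row 0 needs in addition the ratio 2 : 1 of two neighbouring binomial
coefficients. -/
theorem ballot_succ (n k : ℕ) {N : ℕ} (hN : n < N) :
    ballot (n + 1) k = ∑ j ∈ Finset.range N, uniformMatrix k j * ballot n j := by
  have hext : ∑ j ∈ Finset.range N, uniformMatrix k j * ballot n j =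
      ∑ j ∈ Finset.range (N + k + 4), uniformMatrix k j * ballot n j := by
    refine Finset.sum_subset (Finset.range_mono (by omega)) fun j _ hj => ?_
    rw [ballot_eq_zero (by simp at hj; omega), mul_zero]
  rw [hext]
  rcases k with _ | i
  · rw [uniformMatrix_zero_sum (by omega)]
    simp only [ballot]
    have h1 : (3 * n + 3).choose (2 * n + 2) = 3 * ((3 * n).choose (2 * n) +
        2 * (3 * n).choose (2 * n + 1) + (3 * n).choose (2 * n + 2)) := by
      have e1 : (3 * n + 2).choose (2 * n + 1) = 2 * (3 * n + 2).choose (2 * n + 2) := by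
        have := Nat.choose_succ_right_eq (3 * n + 2) (2 * n + 1)
        rw [show 3 * n + 2 - (2 * n + 1) = n + 1 by omega] at this
        refine Nat.eq_of_mul_eq_mul_right (Nat.succ_pos n) ?_
        rw [Nat.succ_eq_add_one, ← this]
        ring
      have e2 : (3 * n + 2).choose (2 * n + 2) = (3 * n).choose (2 * n) +
          2 * (3 * n).choose (2 * n + 1) + (3 * n).choose (2 * n + 2) := by
        simp only [Nat.choose_succ_succ']
        ring
      rw [Nat.choose_succ_succ' (3 * n + 2) (2 * n + 1), e1, e2]
      ring
    rw [show 3 * (n + 1) = 3 * n + 3 by ring, show 2 * (n + 1) + 0 = 2 * n + 2 by ring, h1]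
    push_cast
    simp only [add_zero]
    ring
  · rw [uniformMatrix_succ_sum (by omega)]
    simp only [ballot]
    rw [show 3 * (n + 1) = 3 * n + 3 by ring, show 2 * (n + 1) + (i + 1) = 2 * n + i + 3 by ring,
      choose_three_mul]
    push_cast
    simp only [← add_assoc]
    ring

/-- This is the recurrence of the moments for the parameters `1/3, 2/3, 1/2, 1`. -/
theorem ballot_succ_zero (n : ℕ) :
    (1 / 2 + n) * (1 + n) * ballot (n + 1) 0 = (n + 1 / 3) * (n + 2 / 3) * ballot n 0 := by
  have e1 := Nat.add_one_mul_choose_eq (3 * n + 2) (2 * n + 1)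
  have e2 := Nat.add_one_mul_choose_eq (3 * n + 1) (2 * n)
  have e3 := Nat.choose_mul_succ_eq (3 * n) (2 * n)
  rw [show 3 * n + 1 - 2 * n = n + 1 by omega] at e3
  have f1 : (3 * n + 3 : ℝ) * ((3 * n + 2).choose (2 * n + 1) : ℝ) =
    ((3 * n + 3).choose (2 * n + 2) : ℝ) * (2 * n + 2) := by exact_mod_cast e1
  have f2 : (3 * n + 2 : ℝ) * ((3 * n + 1).choose (2 * n) : ℝ) =
    ((3 * n + 2).choose (2 * n + 1) : ℝ) * (2 * n + 1) := by exact_mod_cast e2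
  have f3 : ((3 * n).choose (2 * n) : ℝ) * (3 * n + 1) =
    ((3 * n + 1).choose (2 * n) : ℝ) * (n + 1) := by exact_mod_cast e3
  have hn : (n + 1 : ℝ) ≠ 0 := by positivity
  simp only [ballot]
  rw [show 3 * (n + 1) = 3 * n + 3 by ring, show 2 * (n + 1) + 0 = 2 * n + 2 by ring]
  refine mul_right_cancel₀ hn ?_
  simp only [add_zero, pow_zero, one_mul, pow_succ]
  linear_combination (4 / 27 : ℝ) ^ n * (4 / 27) * (1 / 4 * (n + 1)) *
    (-(2 * n + 1) * f1 - (3 * n + 3) * f2 - 3 * (3 * n + 2) * f3)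

theorem ballot_one (n : ℕ) : (2 * n + 1) * ballot n 1 = 2 * n * ballot n 0 := by
  have e := Nat.choose_succ_right_eq (3 * n) (2 * n)
  rw [show 3 * n - 2 * n = n by omega] at e
  have f : ((3 * n).choose (2 * n + 1) : ℝ) * (2 * n + 1) = ((3 * n).choose (2 * n) : ℝ) * n := by
    exact_mod_cast e
  simp only [ballot, add_zero, pow_zero, pow_one]
  linear_combination 2 * (4 / 27 : ℝ) ^ n * f

theorem momentMatrix_eq_ballot {a b : ℝ} (ha : 0 < a) (hb : 0 < b) (hab : a + b = 1)
    (hab' : a * b = 2 / 9) (n : ℕ) : momentMatrix a b (1 / 2) 1 n 0 = ballot n 0 := by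
  have hδ : 0 < 1 / 2 + 1 - a - b := by linarith
  have hc : ∀ m : ℕ, (1 / 2 : ℝ) ≠ -m := fun m h => by
    have : (0 : ℝ) ≤ m := m.cast_nonneg
    linarith
  have hd : ∀ m : ℕ, (1 : ℝ) ≠ -m := fun m h => by
    have : (0 : ℝ) ≤ m := m.cast_nonneg
    linarith
  induction n with
  | zero => rw [momentMatrix_zero_zero ha hb hδ hc hd]; simp [ballot]
  | succ n ih =>
    have h1 := momentMatrix_succ_zero ha hb hδ hc hd n
    have h2 := ballot_succ_zero n
    have h3 : (1 / 2 + (n : ℝ)) * (1 + n) ≠ 0 := by positivity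
    rw [ih] at h1
    refine mul_left_cancel₀ h3 ?_
    linear_combination h1 - h2 + n * ballot n 0 * hab + ballot n 0 * hab'

/-- The matrix of the moments in terms of the dual basis; the rows are the `(Jⁿ) 0 j`. -/
def uniformLower : Matrix ℕ ℕ ℝ := fun n j => ballot n j * (27 / 8) ^ j

/-- The Jacobi matrix of the uniform chain. -/
def uniformJacobi : Matrix ℕ ℕ ℝ := fun j k => uniformMatrix k j * (27 / 8) ^ k / (27 / 8) ^ j

theorem isLowerUnitriangular_uniformLower : IsLowerUnitriangular uniformLower := by
  refine ⟨fun n => ?_, fun n m h => by rw [uniformLower, ballot_eq_zero h, zero_mul]⟩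
  rw [uniformLower, ballot, show 2 * n + n = 3 * n by ring, Nat.choose_self, Nat.cast_one, mul_one,
    ← mul_pow, ← mul_pow]
  norm_num

theorem uniformLower_mul_uniformJacobi :
    infMul uniformLower uniformJacobi = infMul shift uniformLower := by
  ext n k
  rw [shift_infMul, isLowerUnitriangular_uniformLower.infMul_apply _ n.lt_succ_self, uniformLower,
    ballot_succ n k n.lt_succ_self, Finset.sum_mul]
  refine Finset.sum_congr rfl fun j _ => ?_
  have : (27 / 8 : ℝ) ^ j ≠ 0 := by positivity
  simp only [uniformLower, uniformJacobi]
  field_simp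

/-- The columns of the upper triangular factor of the moment matrix. -/
def upperColumn (h : ℝ) : ℕ → ℕ → ℝ
  | 0, j => if j = 0 then 1 else 0
  | 1, j => if j = 0 then 1 else if j = 1 then h else 0
  | m + 2, j => ∑ k ∈ Finset.range (m + 1), uniformJacobi j k * upperColumn h m k

theorem upperColumn_eq_zero (h : ℝ) : ∀ {m j : ℕ}, m < j → upperColumn h m j = 0
  | 0, j, hj => by rw [upperColumn, if_neg (by omega)]
  | 1, j, hj => by rw [upperColumn, if_neg (by omega), if_neg (by omega)]
  | m + 2, j, hj => by
    rw [upperColumn]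
    refine Finset.sum_eq_zero fun k hk => ?_
    have := Finset.mem_range.1 hk
    rw [uniformJacobi, uniformMatrix_eq_zero (by omega)]
    simp

theorem upperColumn_self_ne_zero {h : ℝ} (hh : h ≠ 0) : ∀ m : ℕ, upperColumn h m m ≠ 0
  | 0 => by simp [upperColumn]
  | 1 => by simpa [upperColumn]
  | m + 2 => by
    rw [upperColumn, Finset.sum_range_succ, Finset.sum_eq_zero, zero_add]
    · refine mul_ne_zero ?_ (upperColumn_self_ne_zero hh m)
      have h1 : uniformMatrix m (m + 2) ≠ 0 := by
        simp only [uniformMatrix]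
        split_ifs <;> first | omega | norm_num
      rw [uniformJacobi]
      positivity
    · intro k hk
      have := Finset.mem_range.1 hk
      rw [uniformJacobi, uniformMatrix_eq_zero (by omega)]
      simp

/-- In `g`, a shift by two columns is multiplication by `Λ`, and `Λ R = R J`. So if `g = R U` holds
in column `m`, it holds in column `m + 2` with `J` applied to the column of `U`, which is the
recursion of `upperColumn`. -/
theorem uniformLower_mul_upperColumn {g U : Matrix ℕ ℕ ℝ} {h : ℝ}
    (hU : ∀ j m, U j m = upperColumn h m j) (h0 : ∀ n, g n 0 = ballot n 0)
    (h1 : ∀ n, g n 1 = ballot n 0 + h * (ballot n 1 * (27 / 8)))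
    (h2 : ∀ n m, g n (m + 2) = g (n + 1) m) :
    infMul uniformLower U = g := by
  have hcol : ∀ n m, infMul uniformLower U n m =
      ∑ k ∈ Finset.range (m + 1), uniformLower n k * U k m := fun n m =>
    infMul_eq_sum_of_right (N := m + 1) (fun k hk => by rw [hU, upperColumn_eq_zero h hk]) _ n
  have key : ∀ m n, infMul uniformLower U n m = g n m := by
    intro m
    induction m using Nat.twoStepInduction with
    | zero => intro n; simp [hcol, hU, upperColumn, h0, uniformLower]
    | one =>
      intro n
      simp [hcol, hU, upperColumn, h1, uniformLower, Finset.sum_range_succ]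
      ring
    | more m ih _ =>
      intro n
      rw [h2, ← ih, hcol (n + 1), isLowerUnitriangular_uniformLower.infMul_apply _ n.lt_succ_self]
      simp only [hU, upperColumn, Finset.mul_sum]
      rw [Finset.sum_comm]
      refine Finset.sum_congr rfl fun k _ => ?_
      rw [← shift_infMul uniformLower n k, ← uniformLower_mul_uniformJacobi,
        isLowerUnitriangular_uniformLower.infMul_apply _ n.lt_succ_self, Finset.sum_mul]
      exact Finset.sum_congr rfl fun j _ => by ring
  ext n m
  exact key m n

/-- These sums will be `ξ⁽ᵐ⁾(1) = ∑ U k m q⁽ᵏ⁾(1)` with `q⁽ᵏ⁾(1) = (27/8)ᵏ`. They depend only on the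
parity of `m` because the rows of `uniformMatrix` sum to 1. -/
theorem sum_upperColumn {h t : ℝ} (ht : 1 + h * (27 / 8) = t) (m : ℕ) {N : ℕ} (hN : m < N) :
    ∑ k ∈ Finset.range N, upperColumn h m k * (27 / 8) ^ k = if Even m then 1 else t := by
  have hext : ∀ m N, m < N → ∑ k ∈ Finset.range N, upperColumn h m k * (27 / 8) ^ k =
      ∑ k ∈ Finset.range (m + 1), upperColumn h m k * (27 / 8) ^ k := by
    intro m N hN
    refine (Finset.sum_subset (Finset.range_mono (by omega)) fun j _ hj => ?_).symm
    rw [upperColumn_eq_zero h (by simp at hj; omega), zero_mul]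
  rw [hext m N hN]
  clear hN
  induction m using Nat.twoStepInduction with
  | zero => simp [upperColumn]
  | one => simp [upperColumn, Finset.sum_range_succ, ht]
  | more m ih _ =>
    simp only [Nat.even_add, even_two, iff_true]
    rw [← ih]
    simp only [upperColumn, Finset.sum_mul]
    rw [Finset.sum_comm]
    refine Finset.sum_congr rfl fun i hi => ?_
    have hi := Finset.mem_range.1 hi
    have hrow := isStochastic_uniformMatrix.sum_row (n := i) (N := m + 2 + 1)
      fun k hk => uniformMatrix_eq_zero (by omega)
    rw [← mul_one (upperColumn h m i * _), ← hrow, Finset.mul_sum]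
    refine Finset.sum_congr rfl fun k _ => ?_
    have : (27 / 8 : ℝ) ^ k ≠ 0 := by positivity
    simp only [uniformJacobi]
    field_simp

theorem isTypeIStochasticMatrix_uniformMatrix {a b : ℝ} (ha : 0 < a) (hb : 0 < b)
    (hab : a + b = 1) (hab' : a * b = 2 / 9) :
    IsTypeIStochasticMatrix a b (1 / 2) 1 uniformMatrix := by
  have hδ : 0 < 1 / 2 + 1 - a - b := by linarith
  have hc : ∀ m : ℕ, (1 / 2 : ℝ) ≠ -m := fun m h => by
    have : (0 : ℝ) ≤ m := m.cast_nonneg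
    linarith
  have hd : ∀ m : ℕ, (1 : ℝ) ≠ -m := fun m h => by
    have : (0 : ℝ) ≤ m := m.cast_nonneg
    linarith
  -- The future `H 1`, chosen so that `1 + 27h/8 = c/b`, the value of the second weight at 1. It is
  -- nonzero because `ab = 2/9` excludes `a = b = 1/2`.
  obtain ⟨h, hh⟩ : ∃ h : ℝ, h = 8 / 27 * (1 / (2 * b) - 1) := ⟨_, rfl⟩
  have hhb : 27 / 4 * b * h = 1 - 2 * b := by
    rw [hh]
    field_simp
    ring
  have hh0 : h ≠ 0 := by
    rintro rfl
    obtain rfl : b = 1 / 2 := by linarith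
    obtain rfl : a = 1 / 2 := by linarith
    norm_num at hab'
  set g := momentMatrix a b (1 / 2) 1 with hg
  have hg0 : ∀ n, g n 0 = ballot n 0 := momentMatrix_eq_ballot ha hb hab hab'
  have hg1 : ∀ n, g n 1 = ballot n 0 + h * (ballot n 1 * (27 / 8)) := fun n => by
    have h1 := momentMatrix_one ha hb hδ hc hd n
    have h2 := ballot_one n
    have h3 : b * (1 / 2 + (n : ℝ)) ≠ 0 := by positivity
    rw [← hg, hg0] at h1
    refine mul_left_cancel₀ h3 ?_
    linear_combination h1 - (27 / 16) * b * h * h2 - n / 2 * ballot n 0 * hhb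
  set U : Matrix ℕ ℕ ℝ := fun j m => upperColumn h m j with hU
  have hgU : infMul uniformLower U = g :=
    uniformLower_mul_upperColumn (fun _ _ => rfl) hg0 hg1 fun n m => momentMatrix_add_two _ _ _ _ n m
  have hR := isLowerUnitriangular_uniformLower
  obtain ⟨S, hS, hRS, hSR⟩ := hR.exists_inverse
  have hSg : infMul S g = U := by
    rw [← hgU, ← infMul_assoc hS.rowFinite hR.rowFinite, hSR, one_infMul]
  have hU0 : ∀ n, U n n ≠ 0 := upperColumn_self_ne_zero hh0
  -- Dividing each row of `U` by its diagonal entry gives `U = H Vᵀ`, and `T` is the inverse of `V`.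
  obtain ⟨V, hVU⟩ : ∃ V : Matrix ℕ ℕ ℝ, ∀ m k, V m k = U k m / U k k :=
    ⟨fun m k => U k m / U k k, fun _ _ => rfl⟩
  have hV : IsLowerUnitriangular V :=
    ⟨fun n => (hVU n n).trans (div_self (hU0 n)), fun n m hnm => by
      rw [hVU, show U m n = 0 from upperColumn_eq_zero h hnm, zero_div]⟩
  obtain ⟨T, hT, -, hTV⟩ := hV.exists_inverse
  have hUT : infMul U T.transpose = Matrix.diagonal fun n => U n n := by
    ext n m
    have := congrFun (congrFun hTV m) n
    rw [hT.infMul_apply _ m.lt_succ_self] at this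
    rw [infMul_transpose_apply hT]
    have e : ∑ k ∈ Finset.range (m + 1), U n k * T m k =
        U n n * ∑ k ∈ Finset.range (m + 1), T m k * V k n := by
      rw [Finset.mul_sum]
      refine Finset.sum_congr rfl fun k _ => ?_
      have := hU0 n
      rw [hVU]
      field_simp
    rw [e, this, Matrix.one_apply, Matrix.diagonal_apply]
    by_cases hnm : n = m
    · simp [hnm]
    · simp [hnm, Ne.symm hnm]
  -- At 1, `ξ = Uᵀ v` with `v k = (27/8)ᵏ`, and `T Uᵀ = H`; hence `q = H⁻¹ T ξ = v`.
  have hq : ∀ n, linearForm a b (1 / 2) 1 (fun n => U n n) T n 1 = (27 / 8) ^ n := fun n => by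
    have hξ : ∀ j < n + 1, undressed a b (1 / 2) 1 j 1 =
        ∑ k ∈ Finset.range (n + 1), U k j * (27 / 8) ^ k := fun j hj => by
      rw [hU, sum_upperColumn (t := 1 / 2 / b) (by rw [hh]; field_simp; ring) j hj]
      simp [undressed, weight₁, weight₂]
    rw [linearForm, Finset.sum_congr rfl fun j hj => by rw [hξ j (Finset.mem_range.1 hj)]]
    simp only [Finset.mul_sum]
    rw [Finset.sum_comm, Finset.sum_eq_single n]
    · have := congrFun (congrFun hUT n) n
      rw [infMul_transpose_apply hT, Matrix.diagonal_apply_eq] at this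
      have hn := hU0 n
      rw [← Finset.mul_sum]
      have e : ∑ j ∈ Finset.range (n + 1), T n j * (U n j * (27 / 8) ^ n) =
          U n n * (27 / 8) ^ n := by
        rw [← this, Finset.sum_mul]
        exact Finset.sum_congr rfl fun j _ => by ring
      rw [e]
      field_simp
    · intro k _ hk
      have := congrFun (congrFun hUT k) n
      rw [infMul_transpose_apply hT, Matrix.diagonal_apply_ne _ hk] at this
      rw [← Finset.mul_sum]
      have e : ∑ j ∈ Finset.range (n + 1), T n j * (U k j * (27 / 8) ^ k) = 0 := by
        rw [← zero_mul ((27 / 8 : ℝ) ^ k), ← this, Finset.sum_mul]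
        exact Finset.sum_congr rfl fun j _ => by ring
      rw [e, mul_zero]
    · simp
  refine ⟨⟨ha, hb, hδ, S, fun n => U n n, T, uniformJacobi, ⟨hS, hT, hU0, by rw [← hg, hSg, hUT]⟩,
    ⟨uniformLower, hR, hSR, ?_⟩, fun n m => ?_⟩, isStochastic_uniformMatrix⟩
  · rw [infMul_assoc hS.rowFinite rowFinite_shift, ← uniformLower_mul_uniformJacobi,
      ← infMul_assoc hS.rowFinite hR.rowFinite, hSR, one_infMul]
  · rw [hq, hq, uniformJacobi]
    have h1 : (27 / 8 : ℝ) ^ n ≠ 0 := by positivity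
    have h2 : (27 / 8 : ℝ) ^ m ≠ 0 := by positivity
    field_simp

end HyperWalk

end

theorem mainTheorem10 :
    -- exactly one hypergeometric type I stochastic matrix has a uniform stochastic factorization
    (∀ P : Matrix ℕ ℕ ℝ,
      ((∃ a b c d : ℝ, HyperWalk.IsTypeIStochasticMatrix a b c d P) ∧
        ∃ L U₂ U₁ : Matrix ℕ ℕ ℝ, HyperWalk.IsUniformStochasticFactorization P L U₂ U₁) ↔
      P = HyperWalk.uniformMatrix) ∧
    -- its hypergeometric tuples
    (∀ a b c d : ℝ, HyperWalk.IsTypeIStochasticMatrix a b c d HyperWalk.uniformMatrix ↔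
      (a = 1 / 3 ∧ b = 2 / 3 ∧ c = 1 / 2 ∧ d = 1) ∨
      (a = 2 / 3 ∧ b = 1 / 3 ∧ c = 1 / 2 ∧ d = 1)) ∧
    -- its uniform factors
    (∀ L U₂ U₁ : Matrix ℕ ℕ ℝ,
      HyperWalk.IsUniformStochasticFactorization HyperWalk.uniformMatrix L U₂ U₁ ↔
      L = HyperWalk.deathFactor ∧ U₂ = HyperWalk.birthFactor ∧ U₁ = HyperWalk.birthFactor) := by
  refine ⟨fun P => ⟨?_, ?_⟩, fun a b c d => ⟨fun h => h.tuple_eq, ?_⟩, fun L U₂ U₁ =>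
    ⟨fun h => h.eq_of_uniformMatrix, ?_⟩⟩
  · rintro ⟨⟨a, b, c, d, hI⟩, L, U₂, U₁, hf⟩
    have hP := hf.eq_bandMatrix
    rw [hP] at hI
    obtain ⟨⟨h1, h2, h3, h4⟩, -⟩ := hI.eq_of_bandMatrix
    rw [hP, h2, h3, h4, h1, HyperWalk.uniformMatrix_eq_bandMatrix]
  · rintro rfl
    exact ⟨⟨1 / 3, 2 / 3, 1 / 2, 1, HyperWalk.isTypeIStochasticMatrix_uniformMatrix (by norm_num)
      (by norm_num) (by norm_num) (by norm_num)⟩, _, _, _,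
      HyperWalk.isUniformStochasticFactorization_uniformMatrix⟩
  · rintro (⟨rfl, rfl, rfl, rfl⟩ | ⟨rfl, rfl, rfl, rfl⟩) <;>
      exact HyperWalk.isTypeIStochasticMatrix_uniformMatrix (by norm_num) (by norm_num)
        (by norm_num) (by norm_num)
  · rintro ⟨rfl, rfl, rfl⟩
    exact HyperWalk.isUniformStochasticFactorization_uniformMatrix
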